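/- Let $k\ge 2$ and let $\Gamma^k=(V,L)$ be the $k$-regular tree (Cayley tree of order $k$: the infinite tree in which every vertex has exactly $k+1$ neighbours). Fix a root $\rho\in V$, orient every edge away from $\rho$, and let $\vec L$ be the set of oriented edges. Consider the SOS model with heights in $\mathbb Z$ at inverse temperature $\beta>0$, with Hamiltonian $\sum_{\langle x,y\rangle\in L}|\omega_x-\omega_y|$, transfer operator $Q(n)=e^{-\beta|n|}$ and parameter $\tau=2\cosh\beta$. A gradient Gibbs measure (GGM) is a probability measure $\nu$ on $\mathbb Z^{\vec L}$ (with the product $\sigma$-algebra) such that $\int F\,d\nu=\int\nu(d\zeta)\int\gamma'_\Lambda(d\eta\mid\zeta)F(\eta)$ for all finite $\Lambda\subset V$ and all bounded measurable $F$. Here $\gamma'_\Lambda(\cdot\mid\zeta)$ is the image, under $\omega\mapsto\nabla\omega=(\omega_y-\omega_x)_{\langle x,y\rangle\in\vec L}$, of the finite-volume Gibbs measure of the model in $\Lambda$ whose boundary condition is any height configuration with gradient $\zeta$. A (spatially homogeneous) boundary law is a function $l:\mathbb Z\to(0,\infty)$ for which there is $c>0$ with $l(i)=c\bigl(\sum_{j\in\mathbb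 Z}Q(i-j)\,l(j)\bigr)^k$ for all $i\in\mathbb Z$, the sums being finite. A GGM $\nu$ is associated with a $q$-periodic boundary law $l$ if for every finite connected $\Lambda\subset V$, $\Lambda\neq\emptyset$, there is a constant $Z_\Lambda>0$ such that for all $w\in\Lambda$ and $\zeta\in\mathbb Z^{\vec L}$ $$\nu\bigl(\eta_b=\zeta_b\text{ for all edges }b\subset\Lambda\cup\partial\Lambda\bigr)=Z_\Lambda\Bigl(\sum_{s=0}^{q-1}\prod_{y\in\partial\Lambda}l\bigl(s+\textstyle\sum_{b\in\Gamma(w,y)}\zeta_b\bigr)\Bigr)\prod_{b\cap\Lambda\ne\emptyset}Q(\zeta_b),$$ where $\partial\Lambda$ is the outer vertex boundary and $\Gamma(w,y)$ the path from $w$ to $y$ ($\zeta_b$ is counted with a minus sign if $b$ is crossed against its orientation). For $a>0$ put $z^{(a)}_n=1$ if $n\equiv0\pmod 3$ and $z^{(a)}_n=a^k$ otherwise. Call a GGM *of type 3* if it is associated with a boundary law $z^{(a)}$ for some $a>0$, $a\neq1$ (considered with period $3$). **Theorem.** Let $\tau_0=\frac{2k+1}{k-1}$. There is a number $\tau_c=\tau_c(k)$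 with $0<\tau_c<\tau_0$ such that for every $\beta>0$, with $\tau=2\cosh\beta$: 1. if $\tau<\tau_c$, there is no GGM of type 3; 2. if $\tau=\tau_c$, there is exactly one GGM of type 3; 3. if $\tau>\tau_c$ and $\tau\ne\tau_0$, there are exactly two GGMs of type 3; if $\tau=\tau_0$, there is exactly one. Moreover, no GGM of type 3 is associated with a 4-periodic boundary law with values $1,a^k,1,b^k$ ($a,b>0$) at $n\equiv0,1,2,3\pmod 4$, respectively. -/

import Mathlib

open MeasureTheory

namespace SOS

noncomputable section

universe u

variable {V : Type u}

/-- An edge `⟨x, y⟩` of the graph, oriented away from the root `ρ`. In a tree every edge has exactly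
one such orientation. -/
structure OrientedEdge (G : SimpleGraph V) (ρ : V) where
  tail : V
  head : V
  adj : G.Adj tail head
  away : G.dist ρ head = G.dist ρ tail + 1

/-- Gradient configurations, with the product `σ`-algebra (`ℤ` carries its power set). -/
abbrev GradConf (G : SimpleGraph V) (ρ : V) : Type u := OrientedEdge G ρ → ℤ

/-- The gradient field of a height configuration. -/
def grad (G : SimpleGraph V) (ρ : V) (ω : V → ℤ) : GradConf G ρ :=
  fun b => ω b.head - ω b.tail

open Classical in
/-- The height increment prescribed by `ζ` when the edge `d` is crossed from `d.fst` to `d.snd`: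
`ζ` of the edge if it is crossed along its orientation, minus that value otherwise. -/
def increment {G : SimpleGraph V} {ρ : V} (ζ : GradConf G ρ) (d : G.Dart) : ℤ :=
  if h : G.dist ρ d.snd = G.dist ρ d.fst + 1 then ζ ⟨d.fst, d.snd, d.adj, h⟩
  else if h' : G.dist ρ d.fst = G.dist ρ d.snd + 1 then - ζ ⟨d.snd, d.fst, d.adj.symm, h'⟩
  else 0

/-- The unique path between two vertices of a tree. -/
def treePath {G : SimpleGraph V} (hG : G.IsTree) (x y : V) : G.Walk x y :=
  (hG.existsUnique_path x y).choose

/-- The height configuration with height `i` at `x` and gradient field `ζ`. -/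
def heightConf {G : SimpleGraph V} (hG : G.IsTree) {ρ : V} (x : V) (i : ℤ) (ζ : GradConf G ρ) :
    V → ℤ :=
  fun y => i + (((treePath hG x y).darts).map (increment ζ)).sum

/-- The outer boundary of a set of vertices. -/
def outerBoundary (G : SimpleGraph V) (Λ : Finset V) : Set V :=
  {y | y ∉ Λ ∧ ∃ x ∈ Λ, G.Adj x y}

/-- The edges with at least one endpoint in `Λ`. -/
def edgesMeeting (G : SimpleGraph V) (ρ : V) (Λ : Finset V) : Set (OrientedEdge G ρ) :=
  {b | b.tail ∈ Λ ∨ b.head ∈ Λ}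

/-! ### The Gibbsian and the gradient Gibbs specification -/

/-- The SOS Hamiltonian in the finite volume `Λ`. -/
def hamiltonian (G : SimpleGraph V) (ρ : V) (Λ : Finset V) (ω : V → ℤ) : ℝ :=
  ∑ᶠ b ∈ edgesMeeting G ρ Λ, |((grad G ρ ω b : ℤ) : ℝ)|

open Classical in
/-- The configuration equal to `σ` on `Λ` and to `ω` off `Λ`. -/
def glue (Λ : Finset V) (σ : Λ → ℤ) (ω : V → ℤ) : V → ℤ :=
  fun x => if h : x ∈ Λ then σ ⟨x, h⟩ else ω x

/-- The unnormalised finite-volume Gibbs measure with boundary condition `ω`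
(a-priori measure: counting measure). -/
def boltzmann (G : SimpleGraph V) (ρ : V) (β : ℝ) (Λ : Finset V) (ω : V → ℤ) :
    Measure (V → ℤ) :=
  Measure.sum fun σ : Λ → ℤ =>
    ENNReal.ofReal (Real.exp (-β * hamiltonian G ρ Λ (glue Λ σ ω))) • Measure.dirac (glue Λ σ ω)

/-- The Gibbsian specification of the SOS model at inverse temperature `β`. -/
def gibbsSpec (G : SimpleGraph V) (ρ : V) (β : ℝ) (Λ : Finset V) (ω : V → ℤ) :
    Measure (V → ℤ) :=
  (boltzmann G ρ β Λ ω Set.univ)⁻¹ • boltzmann G ρ β Λ ω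

/-- The gradient Gibbs specification. The height configuration with gradient `ζ` is pinned to
height `0` at the root; as the Hamiltonian depends on height differences only, another
normalisation gives the same measure. -/
def gradSpec {G : SimpleGraph V} (hG : G.IsTree) {ρ : V} (β : ℝ) (Λ : Finset V)
    (ζ : GradConf G ρ) : Measure (GradConf G ρ) :=
  (gibbsSpec G ρ β Λ (heightConf hG ρ 0 ζ)).map (grad G ρ)

/-- Gradient Gibbs measures: probability measures on gradient configurations that satisfy the DLR
equation in every finite volume. -/
def IsGradientGibbs {G : SimpleGraph V} (hG : G.IsTree) {ρ : V} (β : ℝ)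
    (ν : Measure (GradConf G ρ)) : Prop :=
  IsProbabilityMeasure ν ∧
    ∀ (Λ : Finset V) (F : GradConf G ρ → ℝ), Measurable F → (∃ C : ℝ, ∀ ζ, |F ζ| ≤ C) →
      ∫ ζ, F ζ ∂ν = ∫ ζ, (∫ η, F η ∂(gradSpec hG β Λ ζ)) ∂ν

/-! ### Boundary laws and their gradient Gibbs measures -/

/-- The SOS transfer operator, `Q(n) = θ ^ |n|` with `θ = exp (-β)`. -/
def transfer (β : ℝ) (n : ℤ) : ℝ := Real.exp (-β * |(n : ℝ)|)

/-- Spatially homogeneous boundary laws for the SOS model on the `k`-regular tree. -/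
def IsBoundaryLaw (k : ℕ) (β : ℝ) (l : ℤ → ℝ) : Prop :=
  (∀ i, 0 < l i) ∧ (∀ i, Summable fun j : ℤ => transfer β (i - j) * l j) ∧
    ∃ c : ℝ, 0 < c ∧ ∀ i, l i = c * (∑' j : ℤ, transfer β (i - j) * l j) ^ k

/-- The gradient configurations that agree with `ζ` on all edges inside `Λ ∪ ∂Λ`. -/
def cylinder {G : SimpleGraph V} {ρ : V} (Λ : Finset V) (ζ : GradConf G ρ) :
    Set (GradConf G ρ) :=
  {η | ∀ b : OrientedEdge G ρ, b.tail ∈ (Λ : Set V) ∪ outerBoundary G Λ →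
    b.head ∈ (Λ : Set V) ∪ outerBoundary G Λ → η b = ζ b}

/-- `ν` has the finite-volume marginals prescribed by the `q`-periodic homogeneous
boundary law `l`:
`ν(η = ζ on Λ ∪ ∂Λ) = Z_Λ (∑_{s mod q} ∏_{y ∈ ∂Λ} l(s + ∑_{b ∈ Γ(w,y)} ζ_b)) ∏_{b ∩ Λ ≠ ∅} Q(ζ_b)`
for all finite connected `Λ` and all `w ∈ Λ`. -/
def HasMarginals {G : SimpleGraph V} (hG : G.IsTree) {ρ : V} (β : ℝ) (q : ℕ) (l : ℤ → ℝ)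
    (ν : Measure (GradConf G ρ)) : Prop :=
  ∀ Λ : Finset V, (G.induce (Λ : Set V)).Connected →
    ∃ Z : ℝ, 0 < Z ∧ ∀ w ∈ Λ, ∀ ζ : GradConf G ρ,
      ν (cylinder Λ ζ) = ENNReal.ofReal
        (Z * (∑ s ∈ Finset.range q,
            ∏ᶠ y ∈ outerBoundary G Λ, l (heightConf hG w (s : ℤ) ζ y)) *
          ∏ᶠ b ∈ edgesMeeting G ρ Λ, transfer β (ζ b))

/-- `ν` is a gradient Gibbs measure and is the one associated with the homogeneous
boundary law `l` of period `q`. -/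
def IsGGMOf {G : SimpleGraph V} (hG : G.IsTree) {ρ : V} (k : ℕ) (β : ℝ) (q : ℕ) (l : ℤ → ℝ)
    (ν : Measure (GradConf G ρ)) : Prop :=
  IsBoundaryLaw k β l ∧ (∀ i, l (i + q) = l i) ∧ IsGradientGibbs hG β ν ∧
    HasMarginals hG β q l ν

/-- The sequence `u` with `u_n = 1` for `n ≡ 0 mod 3` and `u_n = a` otherwise. -/
def u3 (a : ℝ) (n : ℤ) : ℝ := if n % 3 = 0 then 1 else a

/-- The sequence `u` with values `1, a, 1, b` at `n ≡ 0, 1, 2, 3 mod 4`. -/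
def u4 (a b : ℝ) (n : ℤ) : ℝ := if n % 4 = 1 then a else if n % 4 = 3 then b else 1

/-- The gradient Gibbs measures of the nontrivial 3-periodic boundary laws `u_n ^ k`, where
`u = (1, a, a)` and `a ≠ 1`. -/
def ggm3 {G : SimpleGraph V} (hG : G.IsTree) (ρ : V) (k : ℕ) (β : ℝ) :
    Set (Measure (GradConf G ρ)) :=
  {ν | ∃ a : ℝ, 0 < a ∧ a ≠ 1 ∧ IsGGMOf hG k β 3 (fun n => u3 a n ^ k) ν}

/-- The gradient Gibbs measures of the 4-periodic boundary laws `u_n ^ k`, where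
`u = (1, a, 1, b)`. -/
def ggm4 {G : SimpleGraph V} (hG : G.IsTree) (ρ : V) (k : ℕ) (β : ℝ) :
    Set (Measure (GradConf G ρ)) :=
  {ν | ∃ a b : ℝ, 0 < a ∧ 0 < b ∧ IsGGMOf hG k β 4 (fun n => u4 a b n ^ k) ν}

end

end SOS

namespace SOS

noncomputable section

universe u

variable {V : Type u}

/-! ### The curve of nontrivial `3`-periodic boundary laws -/

/-! The proof has an algebraic half, which counts boundary laws, and a probabilistic half, which
shows that counting laws is the same as counting measures.

Algebra. Up to a constant, `transfer` is the Green's function of the second difference minus `τ -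
2`, so convolution with it is inverted by a three-term recurrence (`conv_recurrence`). For the law
with values `1, a^k, a^k` the convolution takes only two values `S₀, S₁`, and the recurrence gives
`S₁ / S₀ = (1 + τ a^k) / (τ - 1 + 2 a^k)`. The law is a boundary law iff this ratio is `a`. The
trivial root `a = 1` divides out and leaves `tauCurve k a = τ` (`isBoundaryLaw_u3_iff`). The curve
falls and then rises, tends to infinity at both ends, and has its minimum at some `c < 1`; the
minimal value is the critical `τ`. Levels above it are hit twice, but at `τ₀ = tauCurve k 1` one of
the two roots is the excluded `a = 1` (`exists_tau_crit`).

Probability. A periodic boundary law yields a measure: choose the root height modulo the period with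
weight proportional to `conv ^ (k + 1)`, then run a tree-indexed Markov chain with steps `stepProb`.
The boundary law equation makes the cylinder probabilities telescope to the prescribed form
(`exists_measure_marginalOn`). These marginals determine the measure, and they imply the DLR
equation because a change of finitely many heights multiplies cylinder probabilities by a ratio of
Boltzmann weights (`lintegral_shiftConf`).

Conversely, the measure determines `a`: the marginals on the star of the root give, up to one
factor, the correlation sums `starFactor`, and a ratio of their differences determines `1 + A + ...
+ A^(k-1)` with `A = a^k`, hence `A` (`eq_of_slope_eq`). A measure that also came from a 4-periodic
law would have star sums of periods 3 and 4, hence constant in that height, which forces `a = 1`. -/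

/-- The value of `τ = 2 cosh β` for which `(1, a, a)` solves the boundary law equation. -/
def tauCurve (k : ℕ) (a : ℝ) : ℝ := 2 + (1 + 2 * a ^ k) / ∑ i ∈ Finset.Ico 1 k, a ^ i

/-- A strictly increasing function with the sign of the derivative of `tauCurve`. -/
def tauSlope (k : ℕ) (a : ℝ) : ℝ :=
  ∑ i ∈ Finset.Ico 1 k, (2 * ((k : ℝ) - i) * a ^ i - i * (a ^ (k - i))⁻¹)

lemma sum_Ico_pow_pos {k : ℕ} (hk : 2 ≤ k) {a : ℝ} (ha : 0 < a) :
    0 < ∑ i ∈ Finset.Ico 1 k, a ^ i :=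
  Finset.sum_pos (fun i _ => pow_pos ha i) ⟨1, by simp; omega⟩

/-- Each summand is strictly increasing, since `a ^ i` increases, `(a ^ (k - i))⁻¹` decreases, and
both coefficients are positive for `1 ≤ i < k`. -/
lemma tauSlope_strictMonoOn {k : ℕ} (hk : 2 ≤ k) : StrictMonoOn (tauSlope k) (Set.Ioi 0) := by
  intro a ha b hb hab
  have ha' : 0 < a := ha
  refine Finset.sum_lt_sum_of_nonempty ⟨1, by simp; omega⟩ fun i hi => ?_
  rw [Finset.mem_Ico] at hi
  have hki : (0 : ℝ) < (k : ℝ) - i := by rw [sub_pos]; exact_mod_cast hi.2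
  have h1 : a ^ i < b ^ i := pow_lt_pow_left₀ hab ha'.le (by omega)
  have h2 : (b ^ (k - i))⁻¹ < (a ^ (k - i))⁻¹ := by
    apply inv_strictAnti₀ (pow_pos ha' _)
    exact pow_lt_pow_left₀ hab ha'.le (by omega)
  have h3 : (0 : ℝ) < i := by exact_mod_cast hi.1
  nlinarith [mul_lt_mul_of_pos_left h1 hki, mul_lt_mul_of_pos_left h2 h3]

lemma tauSlope_continuousOn (k : ℕ) : ContinuousOn (tauSlope k) (Set.Ioi 0) := by
  refine continuousOn_finsetSum _ fun i _ => ?_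
  refine ContinuousOn.sub (by fun_prop) (ContinuousOn.mul (by fun_prop) ?_)
  exact ContinuousOn.inv₀ (by fun_prop) fun x hx => (pow_pos hx _).ne'

lemma tauSlope_one_pos {k : ℕ} (hk : 2 ≤ k) : 0 < tauSlope k 1 := by
  -- The upper end of the sum is separated from the `k` in the summand so that induction applies; at
  -- `n = k - 1` the value is `k (k - 1) / 2`.
  have h : ∀ n : ℕ, ∑ i ∈ Finset.Ico 1 (n + 1), (2 * ((k : ℝ) - i) - i)
      = 2 * k * n - 3 * (n * (n + 1) / 2) := by
    intro n
    induction n with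
    | zero => simp
    | succ n ih => rw [Finset.sum_Ico_succ_top (by omega), ih]; push_cast; ring
  obtain ⟨n, rfl⟩ : ∃ n, k = n + 1 := ⟨k - 1, by omega⟩
  have h' := h n
  simp only [tauSlope, one_pow, inv_one, mul_one]
  rw [h']
  have : (1 : ℝ) ≤ n := by exact_mod_cast (by omega : 1 ≤ n)
  push_cast
  nlinarith

lemma exists_tauSlope_neg {k : ℕ} (hk : 2 ≤ k) : ∃ a : ℝ, 0 < a ∧ a < 1 ∧ tauSlope k a < 0 := by
  have hk' : (2 : ℝ) ≤ k := by exact_mod_cast hk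
  have ha : (0 : ℝ) < (2 * k : ℝ)⁻¹ := by positivity
  have ha1 : (2 * k : ℝ)⁻¹ < 1 := inv_lt_one_of_one_lt₀ (by linarith)
  -- With `a = 1 / (2k)` every summand is negative: its sign is that of `2 (k - i) a^k - i`, and `2
  -- (k - i) a^k ≤ 2 (k - i) a < 1 ≤ i`.
  refine ⟨(2 * k : ℝ)⁻¹, ha, ha1, ?_⟩
  refine Finset.sum_neg (fun i hi => ?_) ⟨1, by simp; omega⟩
  rw [Finset.mem_Ico] at hi
  set a := (2 * k : ℝ)⁻¹ with hadef
  have hak : 2 * k * a = 1 := by rw [hadef]; field_simp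
  have h0 : (0 : ℝ) < a ^ (k - i) := pow_pos ha _
  have h1 : a ^ i * a ^ (k - i) = a ^ k := by rw [← pow_add]; congr 1; omega
  have h2 : a ^ k ≤ a := by
    calc a ^ k ≤ a ^ 1 := pow_le_pow_of_le_one ha.le ha1.le (by omega)
      _ = a := pow_one a
  have hi1 : (1 : ℝ) ≤ i := by exact_mod_cast hi.1
  have hi2 : (i : ℝ) < k := by exact_mod_cast hi.2
  have h3 : 2 * ((k : ℝ) - i) * a ^ k - i < 0 := by
    have : 2 * ((k : ℝ) - i) * a ^ k ≤ 2 * ((k : ℝ) - i) * a := by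
      gcongr
    nlinarith
  have h4 : 2 * ((k : ℝ) - i) * a ^ i - i * (a ^ (k - i))⁻¹
      = (2 * ((k : ℝ) - i) * a ^ k - i) * (a ^ (k - i))⁻¹ := by
    rw [← h1]; field_simp
  rw [h4]
  exact mul_neg_of_neg_of_pos h3 (inv_pos.mpr h0)

/-- Quotient rule. Pulling `a ^ (k - 1)` out of the numerator leaves the negative powers in
`tauSlope`, which make it monotone although the numerator itself is not visibly so. -/
lemma hasDerivAt_tauCurve {k : ℕ} (hk : 2 ≤ k) {a : ℝ} (ha : 0 < a) :
    HasDerivAt (tauCurve k) (a ^ (k - 1) * tauSlope k a / (∑ i ∈ Finset.Ico 1 k, a ^ i) ^ 2) a := by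
  have hN : HasDerivAt (fun a : ℝ => 1 + 2 * a ^ k) (2 * (k * a ^ (k - 1))) a :=
    ((hasDerivAt_pow k a).const_mul 2).const_add 1
  have hD : HasDerivAt (fun a : ℝ => ∑ i ∈ Finset.Ico 1 k, a ^ i)
      (∑ i ∈ Finset.Ico 1 k, i * a ^ (i - 1)) a :=
    HasDerivAt.fun_sum fun i _ => hasDerivAt_pow i a
  have h := (hN.div hD (sum_Ico_pow_pos hk ha).ne').const_add 2
  refine HasDerivAt.congr_deriv (f := tauCurve k) h (Eq.symm ?_)
  congr 1
  simp only [tauSlope, Finset.mul_sum]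
  rw [← Finset.sum_sub_distrib]
  refine Finset.sum_congr rfl fun i hi => ?_
  rw [Finset.mem_Ico] at hi
  obtain ⟨j, rfl⟩ : ∃ j, i = j + 1 := ⟨i - 1, by omega⟩
  obtain ⟨m, rfl⟩ : ∃ m, k = j + 1 + (m + 1) := ⟨k - (j + 1) - 1, by omega⟩
  have e1 : j + 1 + (m + 1) - 1 = j + m + 1 := by omega
  have e2 : j + 1 + (m + 1) - (j + 1) = m + 1 := by omega
  rw [e1, e2]
  simp only [Nat.add_sub_cancel]
  have : a ^ (m + 1) ≠ 0 := (pow_pos ha _).ne'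
  push_cast
  field_simp
  ring

lemma tauCurve_continuousOn {k : ℕ} (hk : 2 ≤ k) : ContinuousOn (tauCurve k) (Set.Ioi 0) :=
  fun _ ha => (hasDerivAt_tauCurve hk ha).continuousAt.continuousWithinAt

lemma two_lt_tauCurve {k : ℕ} (hk : 2 ≤ k) {a : ℝ} (ha : 0 < a) : 2 < tauCurve k a := by
  have := sum_Ico_pow_pos hk ha
  have : 0 < (1 + 2 * a ^ k) / ∑ i ∈ Finset.Ico 1 k, a ^ i := by positivity
  unfold tauCurve
  linarith

lemma tauCurve_one {k : ℕ} (hk : 2 ≤ k) : tauCurve k 1 = (2 * (k : ℝ) + 1) / ((k : ℝ) - 1) := by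
  have : (0 : ℝ) < (k : ℝ) - 1 := by
    have : (2 : ℝ) ≤ k := by exact_mod_cast hk
    linarith
  simp only [tauCurve, one_pow, Finset.sum_const, Nat.card_Ico, nsmul_eq_mul, mul_one]
  rw [Nat.cast_sub (by omega), Nat.cast_one]
  field_simp
  ring

lemma exists_tauCurve_min {k : ℕ} (hk : 2 ≤ k) : ∃ c : ℝ, 0 < c ∧ c < 1 ∧
    StrictAntiOn (tauCurve k) (Set.Ioc 0 c) ∧ StrictMonoOn (tauCurve k) (Set.Ici c) := by
  obtain ⟨a, ha0, ha1, han⟩ := exists_tauSlope_neg hk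
  obtain ⟨c, hc, hc0⟩ : (0 : ℝ) ∈ tauSlope k '' Set.Icc a 1 :=
    intermediate_value_Icc ha1.le ((tauSlope_continuousOn k).mono
      fun x hx => lt_of_lt_of_le ha0 hx.1) ⟨han.le, (tauSlope_one_pos hk).le⟩
  have hcpos : 0 < c := ha0.trans_le hc.1
  have hc1 : c < 1 := lt_of_le_of_ne hc.2 (by rintro rfl; exact (tauSlope_one_pos hk).ne' hc0)
  refine ⟨c, hcpos, hc1, ?_, ?_⟩
  · refine strictAntiOn_of_deriv_neg (convex_Ioc 0 c)
      ((tauCurve_continuousOn hk).mono fun x hx => hx.1) fun x hx => ?_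
    rw [interior_Ioc] at hx
    rw [(hasDerivAt_tauCurve hk hx.1).deriv]
    have : tauSlope k x < 0 := hc0 ▸ tauSlope_strictMonoOn hk hx.1 hcpos hx.2
    exact div_neg_of_neg_of_pos (mul_neg_of_pos_of_neg (pow_pos hx.1 _) this)
      (pow_pos (sum_Ico_pow_pos hk hx.1) 2)
  · refine strictMonoOn_of_deriv_pos (convex_Ici c)
      ((tauCurve_continuousOn hk).mono fun x hx => hcpos.trans_le hx) fun x hx => ?_
    rw [interior_Ici] at hx
    have hx0 : 0 < x := hcpos.trans hx
    rw [(hasDerivAt_tauCurve hk hx0).deriv]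
    have : 0 < tauSlope k x := hc0 ▸ tauSlope_strictMonoOn hk hcpos hx0 hx
    exact div_pos (mul_pos (pow_pos hx0 _) this) (pow_pos (sum_Ico_pow_pos hk hx0) 2)

/-- `tauCurve` is unbounded near `0`. -/
lemma le_tauCurve_of_le_one {k : ℕ} (hk : 2 ≤ k) {a : ℝ} (ha : 0 < a) (ha1 : a ≤ 1) :
    1 / (k * a) ≤ tauCurve k a := by
  have hS := sum_Ico_pow_pos hk ha
  have hk' : (0 : ℝ) < k := by exact_mod_cast (by omega : 0 < k)
  have hSle : ∑ i ∈ Finset.Ico 1 k, a ^ i ≤ k * a := by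
    calc ∑ i ∈ Finset.Ico 1 k, a ^ i ≤ ∑ i ∈ Finset.Ico 1 k, a := by
          refine Finset.sum_le_sum fun i hi => ?_
          rw [Finset.mem_Ico] at hi
          exact pow_le_of_le_one ha.le ha1 (by omega)
      _ = ((k - 1 : ℕ) : ℝ) * a := by simp
      _ ≤ k * a := by gcongr; omega
  have : 1 / (k * a) ≤ (1 + 2 * a ^ k) / ∑ i ∈ Finset.Ico 1 k, a ^ i := by
    apply div_le_div₀ (by positivity) _ hS hSle
    linarith [pow_pos ha k]
  unfold tauCurve
  linarith

/-- `tauCurve` is unbounded near infinity. -/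
lemma le_tauCurve_of_one_le {k : ℕ} (hk : 2 ≤ k) {a : ℝ} (ha1 : 1 ≤ a) :
    a / k ≤ tauCurve k a := by
  have ha : 0 < a := by linarith
  have hS := sum_Ico_pow_pos hk ha
  have hk' : (0 : ℝ) < k := by exact_mod_cast (by omega : 0 < k)
  have hSle : ∑ i ∈ Finset.Ico 1 k, a ^ i ≤ k * a ^ (k - 1) := by
    calc ∑ i ∈ Finset.Ico 1 k, a ^ i ≤ ∑ i ∈ Finset.Ico 1 k, a ^ (k - 1) := by
          refine Finset.sum_le_sum fun i hi => ?_
          rw [Finset.mem_Ico] at hi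
          exact pow_le_pow_right₀ ha1 (by omega)
      _ = ((k - 1 : ℕ) : ℝ) * a ^ (k - 1) := by simp
      _ ≤ k * a ^ (k - 1) := by gcongr; omega
  have : a / k ≤ (1 + 2 * a ^ k) / ∑ i ∈ Finset.Ico 1 k, a ^ i := by
    rw [div_le_div_iff₀ hk' hS]
    calc a * ∑ i ∈ Finset.Ico 1 k, a ^ i ≤ a * (k * a ^ (k - 1)) := by gcongr
      _ = a ^ k * k := by
        obtain ⟨m, rfl⟩ : ∃ m, k = m + 1 := ⟨k - 1, by omega⟩
        simp only [Nat.add_sub_cancel]; ring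
      _ ≤ (1 + 2 * a ^ k) * k := by gcongr; linarith [pow_pos ha k]
  unfold tauCurve
  linarith

/-- The number of nontrivial solutions of `tauCurve k a = τ`. -/
theorem exists_tau_crit {k : ℕ} (hk : 2 ≤ k) :
    ∃ τc : ℝ, 0 < τc ∧ τc < tauCurve k 1 ∧ ∀ τ : ℝ,
      (τ < τc → {a : ℝ | 0 < a ∧ a ≠ 1 ∧ tauCurve k a = τ} = ∅) ∧
      (τ = τc → {a : ℝ | 0 < a ∧ a ≠ 1 ∧ tauCurve k a = τ}.encard = 1) ∧
      (τc < τ → τ ≠ tauCurve k 1 → {a : ℝ | 0 < a ∧ a ≠ 1 ∧ tauCurve k a = τ}.encard = 2) ∧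
      (τ = tauCurve k 1 → {a : ℝ | 0 < a ∧ a ≠ 1 ∧ tauCurve k a = τ}.encard = 1) := by
  obtain ⟨c, hc0, hc1, hanti, hmono⟩ := exists_tauCurve_min hk
  have hmin : ∀ a, 0 < a → a ≠ c → tauCurve k c < tauCurve k a := by
    intro a ha hac
    rcases lt_or_gt_of_ne hac with h | h
    · exact hanti ⟨ha, h.le⟩ ⟨hc0, le_rfl⟩ h
    · exact hmono (le_refl c) h.le h
  have hlt1 : tauCurve k c < tauCurve k 1 := hmin 1 one_pos hc1.ne'
  have hk' : (0 : ℝ) < k := by exact_mod_cast (by omega : 0 < k)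
  have hpair : ∀ τ, tauCurve k c < τ → ∃ a b, 0 < a ∧ a < c ∧ c < b ∧
      ∀ x, (0 < x ∧ tauCurve k x = τ) ↔ (x = a ∨ x = b) := by
    intro τ hτ
    have hτ0 : 0 < τ := by linarith [two_lt_tauCurve hk hc0]
    have ha' : ∃ a, 0 < a ∧ a < c ∧ tauCurve k a = τ := by
      -- Chosen so that `1 / (k * e) ≥ τ`, which puts the curve above the level at `e`.
      set e := min c (1 / (k * τ)) with he
      have he0 : 0 < e := lt_min hc0 (by positivity)
      have heτ : τ ≤ tauCurve k e := by
        refine le_trans ?_ (le_tauCurve_of_le_one hk he0 ((min_le_left _ _).trans hc1.le))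
        rw [le_div_iff₀ (by positivity)]
        have : e ≤ 1 / (k * τ) := min_le_right _ _
        rw [le_div_iff₀ (by positivity)] at this
        linarith
      obtain ⟨a, ha, hat⟩ := intermediate_value_Icc' (min_le_left c _)
        ((tauCurve_continuousOn hk).mono fun x hx => he0.trans_le hx.1) ⟨hτ.le, heτ⟩
      exact ⟨a, he0.trans_le ha.1, lt_of_le_of_ne ha.2 (by rintro rfl; exact hτ.ne hat), hat⟩
    have hb' : ∃ b, c < b ∧ tauCurve k b = τ := by
      set e := max 1 (k * τ) with he
      have heτ : τ ≤ tauCurve k e := by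
        refine le_trans ?_ (le_tauCurve_of_one_le hk (le_max_left _ _))
        rw [le_div_iff₀ hk', mul_comm]
        exact le_max_right _ _
      obtain ⟨b, hb, hbt⟩ := intermediate_value_Icc (hc1.le.trans (le_max_left 1 _))
        ((tauCurve_continuousOn hk).mono fun x hx => hc0.trans_le hx.1) ⟨hτ.le, heτ⟩
      exact ⟨b, lt_of_le_of_ne hb.1 (by rintro rfl; exact hτ.ne hbt), hbt⟩
    obtain ⟨a, ha0, hac, hat⟩ := ha'
    obtain ⟨b, hbc, hbt⟩ := hb'
    refine ⟨a, b, ha0, hac, hbc, fun x => ⟨fun ⟨hx0, hx⟩ => ?_, ?_⟩⟩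
    · rcases le_total x c with h | h
      · exact Or.inl (hanti.injOn ⟨hx0, h⟩ ⟨ha0, hac.le⟩ (hx.trans hat.symm))
      · exact Or.inr (hmono.injOn h hbc.le (hx.trans hbt.symm))
    · rintro (rfl | rfl)
      · exact ⟨ha0, hat⟩
      · exact ⟨hc0.trans hbc, hbt⟩
  refine ⟨tauCurve k c, by linarith [two_lt_tauCurve hk hc0], hlt1, fun τ => ⟨?_, ?_, ?_, ?_⟩⟩
  · intro h
    ext a
    simp only [Set.mem_ofPred_eq, Set.mem_empty_iff_false, iff_false, not_and]
    rintro ha0 - rfl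
    by_cases hac : a = c
    · exact h.ne (by rw [hac])
    · exact absurd (hmin a ha0 hac) h.le.not_gt
  · rintro rfl
    rw [Set.encard_eq_one]
    refine ⟨c, Set.ext fun a => ⟨fun ⟨ha0, _, ha⟩ => ?_, ?_⟩⟩
    · by_contra hac
      exact (hmin a ha0 hac).ne' ha
    · rintro rfl
      exact ⟨hc0, hc1.ne, rfl⟩
  · intro h hne
    obtain ⟨a, b, ha0, hac, hbc, hab⟩ := hpair τ h
    rw [Set.encard_eq_two]
    refine ⟨a, b, by linarith, Set.ext fun x => ?_⟩
    have hx := hab x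
    simp only [Set.mem_ofPred_eq, Set.mem_insert_iff, Set.mem_singleton_iff, ← hx]
    refine ⟨fun ⟨h0, _, h2⟩ => ⟨h0, h2⟩, fun ⟨h0, h2⟩ => ⟨h0, ?_, h2⟩⟩
    rintro rfl
    exact hne h2.symm
  · rintro rfl
    obtain ⟨a, b, ha0, hac, hbc, hab⟩ := hpair _ hlt1
    -- Since `a < c < 1`, the root `1` at the level `tauCurve k 1` is the larger one.
    have hb1 : 1 = b := ((hab 1).mp ⟨one_pos, rfl⟩).resolve_left (by linarith)
    subst hb1
    rw [Set.encard_eq_one]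
    refine ⟨a, Set.ext fun x => ?_⟩
    have hx := hab x
    simp only [Set.mem_ofPred_eq, Set.mem_singleton_iff]
    constructor
    · rintro ⟨h0, h1, h2⟩
      exact (hx.mp ⟨h0, h2⟩).resolve_right h1
    · rintro rfl
      have := hx.mpr (Or.inl rfl)
      exact ⟨this.1, by linarith, this.2⟩

/-! ### Boundary laws -/

lemma transfer_pos (β : ℝ) (n : ℤ) : 0 < transfer β n := Real.exp_pos _

lemma transfer_neg (β : ℝ) (n : ℤ) : transfer β (-n) = transfer β n := by
  simp [transfer]

lemma summable_transfer {β : ℝ} (hβ : 0 < β) : Summable (transfer β) := by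
  have h : Summable fun n : ℕ => transfer β n := by
    have : (fun n : ℕ => transfer β n) = fun n : ℕ => Real.exp (-β) ^ n := by
      ext n
      rw [← Real.exp_nat_mul, transfer]
      congr 1
      simp [mul_comm]
    rw [this]
    exact summable_geometric_of_lt_one (Real.exp_pos _).le (by simpa using hβ)
  exact Summable.of_nat_of_neg h (by simpa [transfer_neg] using h)

/-- Away from `0` the exponential `exp (-β |n|)` is an eigenfunction of the neighbour sum with
eigenvalue `2 cosh β`; the kink at `0` leaves the defect. -/
lemma transfer_recurrence (β : ℝ) (n : ℤ) :
    transfer β (n - 1) + transfer β (n + 1) - 2 * Real.cosh β * transfer β n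
      = if n = 0 then -(2 * Real.sinh β) else 0 := by
  have hc : 2 * Real.cosh β = Real.exp β + Real.exp (-β) := by rw [Real.cosh_eq]; ring
  have hs : 2 * Real.sinh β = Real.exp β - Real.exp (-β) := by rw [Real.sinh_eq]; ring
  rw [hc, hs]
  rcases lt_trichotomy n 0 with h | rfl | h
  · have h1 : |((n - 1 : ℤ) : ℝ)| = 1 - n := by
      rw [abs_of_nonpos (by exact_mod_cast (by omega : n - 1 ≤ 0))]; push_cast; ring
    have h2 : |((n + 1 : ℤ) : ℝ)| = -1 - n := by
      rw [abs_of_nonpos (by exact_mod_cast (by omega : n + 1 ≤ 0))]; push_cast; ring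
    have h3 : |(n : ℝ)| = -n := abs_of_nonpos (by exact_mod_cast h.le)
    rw [if_neg h.ne]
    simp only [transfer, h1, h2, h3]
    rw [add_mul, ← Real.exp_add, ← Real.exp_add]
    ring_nf
  · simp [transfer]
  · have h1 : |((n - 1 : ℤ) : ℝ)| = n - 1 := by
      rw [abs_of_nonneg (by exact_mod_cast (by omega : 0 ≤ n - 1))]; push_cast; ring
    have h2 : |((n + 1 : ℤ) : ℝ)| = n + 1 := by
      rw [abs_of_nonneg (by exact_mod_cast (by omega : 0 ≤ n + 1))]; push_cast; ring
    have h3 : |(n : ℝ)| = n := abs_of_nonneg (by exact_mod_cast h.le)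
    rw [if_neg h.ne']
    simp only [transfer, h1, h2, h3]
    rw [add_mul, ← Real.exp_add, ← Real.exp_add]
    ring_nf

/-- The convolution of the transfer operator with `l`. -/
def conv (β : ℝ) (l : ℤ → ℝ) (i : ℤ) : ℝ := ∑' j : ℤ, transfer β (i - j) * l j

lemma summable_conv {β : ℝ} (hβ : 0 < β) {l : ℤ → ℝ} {C : ℝ} (hl : ∀ i, |l i| ≤ C) (i : ℤ) :
    Summable fun j : ℤ => transfer β (i - j) * l j := by
  have h1 : Summable fun j : ℤ => transfer β (i - j) :=
    (Equiv.subLeft i).summable_iff.mpr (summable_transfer hβ)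
  refine Summable.of_norm_bounded (h1.mul_right C) fun j => ?_
  rw [Real.norm_eq_abs, abs_mul, abs_of_pos (transfer_pos _ _)]
  exact mul_le_mul_of_nonneg_left (hl j) (transfer_pos _ _).le

lemma conv_recurrence {β : ℝ} {l : ℤ → ℝ}
    (hl : ∀ i, Summable fun j : ℤ => transfer β (i - j) * l j) (i : ℤ) :
    conv β l (i - 1) + conv β l (i + 1) - 2 * Real.cosh β * conv β l i
      = -(2 * Real.sinh β) * l i := by
  unfold conv
  rw [← (hl (i - 1)).tsum_add (hl (i + 1)), ← tsum_mul_left,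
    ← ((hl (i - 1)).add (hl (i + 1))).tsum_sub ((hl i).mul_left _)]
  rw [← tsum_ite_eq i (fun j => -(2 * Real.sinh β) * l j)]
  refine tsum_congr fun j => ?_
  have h := transfer_recurrence β (i - j)
  have e1 : i - 1 - j = i - j - 1 := by ring
  have e2 : i + 1 - j = i - j + 1 := by ring
  rw [e1, e2]
  have : transfer β (i - j - 1) * l j + transfer β (i - j + 1) * l j
      - 2 * Real.cosh β * (transfer β (i - j) * l j)
      = (transfer β (i - j - 1) + transfer β (i - j + 1)
        - 2 * Real.cosh β * transfer β (i - j)) * l j := by ring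
  rw [this, h]
  by_cases hij : j = i
  · simp [hij]
  · rw [if_neg hij, if_neg (by omega), zero_mul]

lemma conv_add_period {β : ℝ} {l : ℤ → ℝ} {q : ℤ} (hq : ∀ i, l (i + q) = l i) (i : ℤ) :
    conv β l (i + q) = conv β l i := by
  unfold conv
  rw [← (Equiv.addRight q).tsum_eq]
  refine tsum_congr fun j => ?_
  simp only [Equiv.coe_addRight, hq]
  congr 2
  ring

lemma conv_neg {β : ℝ} {l : ℤ → ℝ} (hl : ∀ i, l (-i) = l i) (i : ℤ) :
    conv β l (-i) = conv β l i := by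
  unfold conv
  rw [← (Equiv.neg ℤ).tsum_eq]
  refine tsum_congr fun j => ?_
  simp only [Equiv.neg_apply, hl]
  rw [← transfer_neg]
  congr 2
  ring

lemma conv_pos {β : ℝ} {l : ℤ → ℝ} (hpos : ∀ i, 0 < l i)
    (hl : ∀ i, Summable fun j : ℤ => transfer β (i - j) * l j) (i : ℤ) : 0 < conv β l i :=
  (hl i).tsum_pos (fun j => (mul_pos (transfer_pos _ _) (hpos j)).le) i
    (mul_pos (transfer_pos _ _) (hpos i))

lemma u3_add_three (a : ℝ) (n : ℤ) : u3 a (n + 3) = u3 a n := by simp [u3]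

lemma u3_neg (a : ℝ) (n : ℤ) : u3 a (-n) = u3 a n := by
  unfold u3
  congr 1
  simp only [eq_iff_iff]
  omega

lemma u3_pos {a : ℝ} (ha : 0 < a) (n : ℤ) : 0 < u3 a n := by
  unfold u3; split_ifs <;> linarith

lemma summable_conv_u3 {β : ℝ} (hβ : 0 < β) (k : ℕ) {a : ℝ} (ha : 0 < a) (i : ℤ) :
    Summable fun j : ℤ => transfer β (i - j) * u3 a j ^ k := by
  refine summable_conv hβ (C := max 1 (a ^ k)) (fun j => ?_) i
  rw [abs_of_pos (pow_pos (u3_pos ha j) k)]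
  unfold u3
  split_ifs <;> simp

/-- The difference of the two sides of the polynomial equation vanishes at `a = 1`; the geometric
sum is what remains after cancelling `a - 1`. -/
lemma algebraic_iff_tauCurve {k : ℕ} (hk : 2 ≤ k) {a τ : ℝ} (ha : 0 < a) (ha1 : a ≠ 1) :
    a * (τ - 1 + 2 * a ^ k) = 1 + τ * a ^ k ↔ tauCurve k a = τ := by
  have hS := sum_Ico_pow_pos hk ha
  have hgeom : (∑ i ∈ Finset.Ico 1 k, a ^ i) * (a - 1) = a ^ k - a := by
    have := geom_sum_Ico_mul a (show 1 ≤ k by omega)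
    simpa using this
  set S := ∑ i ∈ Finset.Ico 1 k, a ^ i with hSdef
  have h1 : tauCurve k a = τ ↔ 1 + 2 * a ^ k = (τ - 2) * S := by
    unfold tauCurve
    rw [← hSdef, ← eq_sub_iff_add_eq', div_eq_iff hS.ne']
  rw [h1, ← mul_left_inj' (c := a - 1) (a := 1 + 2 * a ^ k) (sub_ne_zero.mpr ha1),
    mul_assoc (τ - 2), hgeom]
  constructor <;> intro h <;> linarith

theorem isBoundaryLaw_u3_iff {k : ℕ} (hk : 2 ≤ k) {β : ℝ} (hβ : 0 < β) {a : ℝ} (ha : 0 < a)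
    (ha1 : a ≠ 1) :
    IsBoundaryLaw k β (fun n => u3 a n ^ k) ↔ tauCurve k a = 2 * Real.cosh β := by
  rw [← algebraic_iff_tauCurve hk ha ha1]
  have hsum := fun i => summable_conv_u3 hβ k ha i
  have hpos : ∀ i, 0 < u3 a i ^ k := fun i => pow_pos (u3_pos ha i) k
  set l : ℤ → ℝ := fun n => u3 a n ^ k with hl
  set τ := 2 * Real.cosh β with hτ
  have hτ2 : 2 < τ := by
    have := Real.one_lt_cosh.mpr hβ.ne'
    linarith
  have hS := conv_pos (β := β) hpos hsum
  have hper : ∀ i, conv β l (i + 3) = conv β l i :=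
    conv_add_period fun i => by simp only [hl, u3_add_three]
  have hneg : ∀ i, conv β l (-i) = conv β l i :=
    conv_neg fun i => by simp only [hl, u3_neg]
  have h2 : conv β l 2 = conv β l 1 := by rw [← hneg 1, ← hper (-1)]; norm_num
  have hm1 : conv β l (-1) = conv β l 1 := hneg 1
  have r0 := conv_recurrence hsum 0
  have r1 := conv_recurrence hsum 1
  have l0 : u3 a 0 = 1 := by simp [u3]
  have l1 : u3 a 1 = a := by simp [u3]
  rw [l0, one_pow, mul_one, zero_sub, zero_add] at r0
  change conv β l (-1) + conv β l 1 - τ * conv β l 0 = _ at r0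
  rw [hm1] at r0
  rw [l1] at r1
  norm_num at r1
  change conv β l 0 + conv β l 2 - τ * conv β l 1 = _ at r1
  rw [h2] at r1
  have hak := pow_pos ha k
  have hS0 := hS 0
  have hS1 := hS 1
  change 0 < conv β l 0 at hS0
  change 0 < conv β l 1 at hS1
  -- The unknown `sinh β` is eliminated between the recurrences at heights `0` and `1`.
  have key : conv β l 1 * (τ - 1 + 2 * a ^ k) = conv β l 0 * (1 + τ * a ^ k) := by
    linear_combination -r1 + a ^ k * r0
  have hden : 0 < τ - 1 + 2 * a ^ k := by linarith
  constructor
  · rintro ⟨-, -, c, hc, h⟩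
    have e0 : 1 = c * conv β l 0 ^ k := by
      rw [← one_pow k, ← l0]; exact h 0
    have e1 : a ^ k = c * conv β l 1 ^ k := by
      rw [← l1]; exact h 1
    have e2 : conv β l 1 ^ k = (a * conv β l 0) ^ k := by
      apply mul_left_cancel₀ hc.ne'
      rw [← e1, mul_pow, mul_left_comm, ← e0, mul_one]
    have e3 : conv β l 1 = a * conv β l 0 :=
      (pow_left_inj₀ hS1.le (by positivity) (by omega)).mp e2
    apply mul_left_cancel₀ hS0.ne'
    rw [← key, e3]
    ring
  · intro h
    have e3 : conv β l 1 = a * conv β l 0 := by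
      apply mul_right_cancel₀ hden.ne'
      rw [key, ← h]; ring
    refine ⟨hpos, hsum, (conv β l 0 ^ k)⁻¹, by positivity, fun i => ?_⟩
    have hall : ∀ m : ℤ, ∀ r : ℤ, conv β l (r + 3 * m) = conv β l r := by
      intro m r
      induction m using Int.induction_on with
      | zero => simp
      | succ m ih => rw [← ih, ← hper (r + 3 * m)]; congr 1; ring
      | pred m ih => rw [← ih, ← hper (r + 3 * (-m - 1))]; congr 1; ring
    have hi : conv β l i = u3 a i * conv β l 0 := by
      rw [← Int.emod_add_mul_ediv i 3, hall]
      have hmod : i % 3 = 0 ∨ i % 3 = 1 ∨ i % 3 = 2 := by omega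
      rcases hmod with hm | hm | hm
      · simp [hm, u3]
      · rw [hm, e3]; simp [u3]
      · rw [hm, h2, e3]; simp [u3]
    change u3 a i ^ k = _ * conv β l i ^ k
    rw [hi, mul_pow]
    field_simp

/-! ### Heights and gradients on a tree -/

section Heights

variable {G : SimpleGraph V} (hG : G.IsTree) {ρ : V}

lemma treePath_isPath (x y : V) : (treePath hG x y).IsPath :=
  (hG.existsUnique_path x y).choose_spec.1

lemma eq_treePath {x y : V} {p : G.Walk x y} (hp : p.IsPath) : p = treePath hG x y :=
  (hG.existsUnique_path x y).choose_spec.2 p hp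

lemma length_treePath (x y : V) : (treePath hG x y).length = G.dist x y := by
  obtain ⟨p, hp, hlen⟩ := hG.connected.exists_path_of_dist x y
  rw [← eq_treePath hG hp, hlen]

include hG in
lemma increment_grad (ω : V → ℤ) (d : G.Dart) :
    increment (grad G ρ ω) d = ω d.snd - ω d.fst := by
  unfold increment
  split_ifs with h h'
  · rfl
  · simp [grad]
  -- Adjacent vertices of a tree are never equidistant from the root, so the default value `0` in
  -- `increment` is not reached.
  · exact absurd (hG.dist_eq_dist_add_one_of_adj ρ d.adj) (by tauto)

include hG in
lemma sum_increment_grad (ω : V → ℤ) {x y : V} (p : G.Walk x y) :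
    (p.darts.map (increment (grad G ρ ω))).sum = ω y - ω x := by
  induction p with
  | nil => simp
  | cons h p ih => simp only [SimpleGraph.Walk.darts_cons, List.map_cons, List.sum_cons, ih,
      increment_grad hG]; ring

lemma heightConf_grad (ω : V → ℤ) (w : V) (i : ℤ) (y : V) :
    heightConf hG w i (grad G ρ ω) y = i + (ω y - ω w) := by
  rw [heightConf, sum_increment_grad hG]

/-- The head cannot lie on the path to the tail, because it is farther from the root than the length
of that path. -/
lemma treePath_head (b : OrientedEdge G ρ) :
    treePath hG ρ b.head = (treePath hG ρ b.tail).concat b.adj := by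
  classical
  refine (eq_treePath hG ((treePath_isPath hG ρ b.tail).concat (fun hmem => ?_) b.adj)).symm
  have h1 := SimpleGraph.dist_le ((treePath hG ρ b.tail).takeUntil b.head hmem)
  have h2 := (treePath hG ρ b.tail).length_takeUntil_le_length hmem
  rw [length_treePath] at h2
  have := b.away
  omega

lemma grad_heightConf (i : ℤ) (ζ : GradConf G ρ) : grad G ρ (heightConf hG ρ i ζ) = ζ := by
  ext b
  have : increment ζ ⟨(b.tail, b.head), b.adj⟩ = ζ b := by
    unfold increment
    rw [dif_pos b.away]
  simp only [grad, heightConf, treePath_head hG b, SimpleGraph.Walk.darts_concat,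
    List.concat_eq_append, List.map_append, List.map_cons, List.map_nil, List.sum_append,
    List.sum_cons, List.sum_nil, this]
  ring

include hG in
lemma exists_eq_grad (ζ : GradConf G ρ) : ∃ ω : V → ℤ, ζ = grad G ρ ω :=
  ⟨_, (grad_heightConf hG 0 ζ).symm⟩

include hG in
lemma tail_eq_of_head_eq {b b' : OrientedEdge G ρ} (h : b.head = b'.head) : b.tail = b'.tail := by
  have h1 := congrArg SimpleGraph.Walk.penultimate (treePath_head hG b)
  have h2 := congrArg SimpleGraph.Walk.penultimate (treePath_head hG b')
  rw [SimpleGraph.Walk.penultimate_concat] at h1 h2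
  rw [← h1, ← h2, h]

lemma OrientedEdge.ext_of_eq {b b' : OrientedEdge G ρ} (ht : b.tail = b'.tail)
    (hh : b.head = b'.head) : b = b' := by
  cases b; cases b'; cases ht; cases hh; rfl

include hG in
lemma exists_edge (ρ : V) {x y : V} (h : G.Adj x y) : ∃ b : OrientedEdge G ρ,
    (b.tail = x ∧ b.head = y) ∨ (b.tail = y ∧ b.head = x) := by
  rcases hG.dist_eq_dist_add_one_of_adj ρ h with h' | h'
  · exact ⟨⟨y, x, h.symm, h'⟩, Or.inr ⟨rfl, rfl⟩⟩
  · exact ⟨⟨x, y, h, h'⟩, Or.inl ⟨rfl, rfl⟩⟩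

lemma OrientedEdge.eq_of_swap {b b' : OrientedEdge G ρ} (h1 : b.tail = b'.head)
    (h2 : b.head = b'.tail) : False := by
  have := b.away
  have := b'.away
  rw [h1, h2] at *
  omega

end Heights

/-! ### Finite connected volumes -/

section Volumes

variable {G : SimpleGraph V} {ρ : V}

lemma finite_outerBoundary [G.LocallyFinite] (Λ : Finset V) : (outerBoundary G Λ).Finite := by
  refine (Λ.finite_toSet.biUnion (fun x _ => (G.neighborSet x).toFinite)).subset ?_
  rintro y ⟨-, x, hx, hxy⟩
  exact Set.mem_biUnion (Finset.mem_coe.mpr hx) hxy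

lemma finite_edgesMeeting [G.LocallyFinite] (Λ : Finset V) : (edgesMeeting G ρ Λ).Finite := by
  have hB := (Λ.finite_toSet).union (finite_outerBoundary (G := G) Λ)
  refine Set.Finite.of_injOn (f := fun b : OrientedEdge G ρ => (b.tail, b.head)) ?_ ?_
    (hB.prod hB)
  · intro b hb
    have hadj := b.adj
    rcases hb with h | h
    · refine ⟨Or.inl h, ?_⟩
      by_cases h' : b.head ∈ Λ
      · exact Or.inl h'
      · exact Or.inr ⟨h', _, h, hadj⟩
    · refine ⟨?_, Or.inl h⟩
      by_cases h' : b.tail ∈ Λ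
      · exact Or.inl h'
      · exact Or.inr ⟨h', _, h, hadj.symm⟩
  · intro b _ b' _ h
    exact OrientedEdge.ext_of_eq (Prod.ext_iff.mp h).1 (Prod.ext_iff.mp h).2

lemma exists_path_of_connected {Λ : Finset V} (hΛ : (G.induce (Λ : Set V)).Connected) {u v : V}
    (hu : u ∈ Λ) (hv : v ∈ Λ) : ∃ p : G.Walk u v, p.IsPath ∧ ∀ z ∈ p.support, z ∈ Λ := by
  classical
  obtain ⟨p, hp, -⟩ := hΛ.exists_path_of_dist ⟨u, hu⟩ ⟨v, hv⟩
  refine ⟨p.map (SimpleGraph.Embedding.induce _).toHom,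
    SimpleGraph.Walk.IsPath.map Subtype.val_injective hp, fun z hz => ?_⟩
  erw [SimpleGraph.Walk.support_map, List.mem_map] at hz
  obtain ⟨y, -, rfl⟩ := hz
  exact y.2

/-- A vertex outside a connected volume has at most one neighbour in it. -/
lemma eq_of_adj_of_notMem (hG : G.IsTree) {Λ : Finset V} (hΛ : (G.induce (Λ : Set V)).Connected)
    {x u v : V} (hx : x ∉ Λ) (hu : u ∈ Λ) (hv : v ∈ Λ) (hxu : G.Adj x u) (hxv : G.Adj x v) :
    u = v := by
  obtain ⟨p, hp, hsub⟩ := exists_path_of_connected hΛ hu hv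
  have hxp : x ∉ p.support := fun h => hx (hsub x h)
  have h1 : (SimpleGraph.Walk.cons hxu p).IsPath := hp.cons hxp
  have h2 : (SimpleGraph.Walk.cons hxv SimpleGraph.Walk.nil).IsPath := by
    simp [SimpleGraph.Walk.isPath_def, hxv.ne]
  have h3 := (eq_treePath hG h1).trans (eq_treePath hG h2).symm
  have h4 := congrArg SimpleGraph.Walk.length h3
  simp only [SimpleGraph.Walk.length_cons, SimpleGraph.Walk.length_nil] at h4
  exact SimpleGraph.Walk.eq_of_length_eq_zero (p := p) (by omega)

/-- Two vertices in the outer boundary of a connected volume are not adjacent. -/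
lemma not_adj_of_mem_outerBoundary (hG : G.IsTree) {Λ : Finset V}
    (hΛ : (G.induce (Λ : Set V)).Connected) {x y : V} (hx : x ∈ outerBoundary G Λ)
    (hy : y ∈ outerBoundary G Λ) : ¬ G.Adj x y := by
  intro hxy
  obtain ⟨hx, u, hu, hux⟩ := hx
  obtain ⟨hy, v, hv, hvy⟩ := hy
  obtain ⟨p, hp, hsub⟩ := exists_path_of_connected hΛ hu hv
  have h1 : (p.concat hvy).IsPath := hp.concat (fun h => hy (hsub _ h)) hvy
  have h1' : (SimpleGraph.Walk.cons hux.symm (p.concat hvy)).IsPath := by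
    refine h1.cons ?_
    rw [SimpleGraph.Walk.support_concat, List.mem_append,
      List.mem_singleton]
    rintro (h | h)
    · exact hx (hsub _ h)
    · exact hxy.ne h
  have h2 : (SimpleGraph.Walk.cons hxy SimpleGraph.Walk.nil).IsPath := by
    simp [SimpleGraph.Walk.isPath_def, hxy.ne]
  have h3 := (eq_treePath hG h1').trans (eq_treePath hG h2).symm
  have h4 := congrArg SimpleGraph.Walk.length h3
  simp at h4

/-- An edge inside `Λ ∪ ∂Λ` that misses `Λ` would join two boundary vertices and close a cycle. -/
lemma mem_cylinder_iff (hG : G.IsTree) {Λ : Finset V} (hΛ : (G.induce (Λ : Set V)).Connected)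
    {η ζ : GradConf G ρ} : η ∈ cylinder Λ ζ ↔ ∀ b ∈ edgesMeeting G ρ Λ, η b = ζ b := by
  constructor
  · intro h b hb
    have hadj := b.adj
    rcases hb with hb | hb
    · refine h b (Or.inl hb) ?_
      by_cases h' : b.head ∈ Λ
      · exact Or.inl h'
      · exact Or.inr ⟨h', _, hb, hadj⟩
    · refine h b ?_ (Or.inl hb)
      by_cases h' : b.tail ∈ Λ
      · exact Or.inl h'
      · exact Or.inr ⟨h', _, hb, hadj.symm⟩
  · rintro h b (hb | hb) (hb' | hb')
    · exact h b (Or.inl hb)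
    · exact h b (Or.inl hb)
    · exact h b (Or.inr hb')
    · exact absurd b.adj (not_adj_of_mem_outerBoundary hG hΛ hb hb')

/-- A connected volume strictly inside another one can be enlarged by a boundary vertex. -/
lemma exists_mem_outerBoundary {Λ Λ' : Finset V} (hΛ : Λ.Nonempty)
    (hΛ' : (G.induce (Λ' : Set V)).Connected) (hsub : Λ ⊂ Λ') :
    ∃ x ∈ Λ', x ∈ outerBoundary G Λ := by
  obtain ⟨u, hu⟩ := hΛ
  obtain ⟨v, hv', hv⟩ := Finset.exists_of_ssubset hsub
  obtain ⟨p, -, hp⟩ := exists_path_of_connected hΛ' (hsub.1 hu) hv'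
  obtain ⟨d, hd, hd1, hd2⟩ := p.exists_boundary_dart (Λ : Set V) hu hv
  exact ⟨d.snd, hp _ (p.dart_snd_mem_support_of_mem_darts hd), hd2, d.fst, hd1, d.adj⟩

variable [DecidableEq V]

lemma connected_insert {Λ : Finset V} (hΛ : (G.induce (Λ : Set V)).Connected) {x : V}
    (hx : x ∈ outerBoundary G Λ) : (G.induce ((insert x Λ : Finset V) : Set V)).Connected := by
  obtain ⟨-, p, hp, hpx⟩ := hx
  have : ((insert x Λ : Finset V) : Set V) = (Λ : Set V) ∪ {x} := by
    ext; simp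
  rw [this]
  exact SimpleGraph.connected_induce_union hΛ.preconnected
    (SimpleGraph.Preconnected.of_subsingleton) (Finset.mem_coe.mpr hp) rfl hpx

omit [DecidableEq V] in
lemma connected_singleton (x : V) : (G.induce (({x} : Finset V) : Set V)).Connected := by
  rw [Finset.coe_singleton]
  have : Nonempty ({x} : Set V) := ⟨⟨x, rfl⟩⟩
  exact ⟨SimpleGraph.Preconnected.of_subsingleton⟩

variable [G.LocallyFinite]

/-- The neighbours of `x` other than `p`. -/
def children (G : SimpleGraph V) [G.LocallyFinite] (p x : V) : Finset V :=
  (G.neighborFinset x).erase p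

lemma mem_children {p x y : V} : y ∈ children G p x ↔ y ≠ p ∧ G.Adj x y := by
  simp [children]

lemma card_children {k : ℕ} (hreg : G.IsRegularOfDegree (k + 1)) {p x : V} (h : G.Adj p x) :
    (children G p x).card = k := by
  rw [children, Finset.card_erase_of_mem (by simpa using h.symm),
    SimpleGraph.card_neighborFinset_eq_degree, hreg x, Nat.add_sub_cancel]

variable (hG : G.IsTree) {Λ : Finset V} (hΛ : (G.induce (Λ : Set V)).Connected) {p x : V}
  (hx : x ∉ Λ) (hp : p ∈ Λ) (hpx : G.Adj p x)

include hG hΛ hx hp hpx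

lemma children_notMem {y : V} (hy : y ∈ children G p x) : y ∉ Λ ∧ y ∉ outerBoundary G Λ := by
  rw [mem_children] at hy
  refine ⟨fun h => hy.1 (eq_of_adj_of_notMem hG hΛ hx h hp hy.2 hpx.symm), fun h => ?_⟩
  exact not_adj_of_mem_outerBoundary hG hΛ ⟨hx, p, hp, hpx⟩ h hy.2

lemma outerBoundary_insert :
    outerBoundary G (insert x Λ) = (outerBoundary G Λ \ {x}) ∪ (children G p x : Set V) := by
  ext y
  constructor
  · rintro ⟨hy, z, hz, hzy⟩
    rw [Finset.mem_insert, not_or] at hy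
    rcases Finset.mem_insert.mp hz with rfl | hz
    · right
      refine Finset.mem_coe.mpr (mem_children.mpr ⟨?_, hzy⟩)
      rintro rfl
      exact hy.2 hp
    · exact Or.inl ⟨⟨hy.2, z, hz, hzy⟩, hy.1⟩
  · rintro (⟨⟨hy, z, hz, hzy⟩, hyx⟩ | hy)
    · exact ⟨by simp [hy]; exact hyx, z, Finset.mem_insert_of_mem hz, hzy⟩
    · rw [Finset.mem_coe] at hy
      have h1 := children_notMem hG hΛ hx hp hpx hy
      have h2 := (mem_children.mp hy).2
      exact ⟨by simp [h1.1, h2.ne'], x, Finset.mem_insert_self _ _, h2⟩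

lemma finprod_outerBoundary_insert {M : Type*} [CommMonoid M] (f : V → M) :
    ∏ᶠ y ∈ outerBoundary G (insert x Λ), f y
      = (∏ᶠ y ∈ outerBoundary G Λ \ {x}, f y) * ∏ y ∈ children G p x, f y := by
  rw [outerBoundary_insert hG hΛ hx hp hpx, finprod_mem_union, finprod_mem_coe_finset]
  · rw [Set.disjoint_left]
    intro y hy hy'
    exact (children_notMem hG hΛ hx hp hpx hy').2 hy.1
  · exact (finite_outerBoundary Λ).sdiff
  · exact Finset.finite_toSet _

omit [DecidableEq V] hG hΛ in
lemma finprod_outerBoundary_eq_mul {M : Type*} [CommMonoid M] (f : V → M) :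
    ∏ᶠ y ∈ outerBoundary G Λ, f y = (∏ᶠ y ∈ outerBoundary G Λ \ {x}, f y) * f x := by
  have : outerBoundary G Λ = insert x (outerBoundary G Λ \ {x}) := by
    rw [Set.insert_sdiff_singleton, Set.insert_eq_of_mem]
    exact ⟨hx, p, hp, hpx⟩
  conv_lhs => rw [this]
  rw [finprod_mem_insert _ (by simp) (finite_outerBoundary Λ).sdiff, mul_comm]

/-- When a boundary vertex `x` is added, one new edge to each child of `x` appears. -/
lemma finprod_edgesMeeting_insert {M : Type*} [CommMonoid M] (f : OrientedEdge G ρ → M)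
    (g : V → M) (hfg : ∀ b : OrientedEdge G ρ,
      (b.tail = x → b.head ≠ p → f b = g b.head) ∧ (b.head = x → b.tail ≠ p → f b = g b.tail)) :
    ∏ᶠ b ∈ edgesMeeting G ρ (insert x Λ), f b
      = (∏ᶠ b ∈ edgesMeeting G ρ Λ, f b) * ∏ y ∈ children G p x, g y := by
  classical
  -- Both orientations occur: if the root is not in `Λ`, a neighbour of `x` other than `p` may be
  -- its parent.
  set N : Set (OrientedEdge G ρ) :=
    {b | (b.tail = x ∧ b.head ≠ p) ∨ (b.head = x ∧ b.tail ≠ p)} with hN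
  have hadj : ∀ b : OrientedEdge G ρ, G.Adj b.tail b.head := fun b => b.adj
  have hE : edgesMeeting G ρ (insert x Λ) = edgesMeeting G ρ Λ ∪ N := by
    ext b
    simp only [edgesMeeting, Finset.mem_insert, Set.mem_ofPred_eq, Set.mem_union, hN]
    constructor
    · rintro ((h | h) | (h | h))
      · by_cases h' : b.head = p
        · exact Or.inl (Or.inr (h' ▸ hp))
        · exact Or.inr (Or.inl ⟨h, h'⟩)
      · exact Or.inl (Or.inl h)
      · by_cases h' : b.tail = p
        · exact Or.inl (Or.inl (h' ▸ hp))
        · exact Or.inr (Or.inr ⟨h, h'⟩)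
      · exact Or.inl (Or.inr h)
    · tauto
  have hdisj : Disjoint (edgesMeeting G ρ Λ) N := by
    rw [Set.disjoint_left]
    rintro b hb (⟨h1, h2⟩ | ⟨h1, h2⟩)
    · rcases hb with hb | hb
      · exact hx (h1 ▸ hb)
      · exact h2 (eq_of_adj_of_notMem hG hΛ hx hb hp (h1 ▸ hadj b) hpx.symm)
    · rcases hb with hb | hb
      · exact h2 (eq_of_adj_of_notMem hG hΛ hx hb hp (h1 ▸ (hadj b).symm) hpx.symm)
      · exact hx (h1 ▸ hb)
  have hNfin : N.Finite := (finite_edgesMeeting (insert x Λ)).subset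
    (hE ▸ Set.subset_union_right)
  rw [hE, finprod_mem_union hdisj (finite_edgesMeeting Λ) hNfin]
  congr 1
  rw [← finprod_mem_coe_finset]
  refine finprod_mem_eq_of_bijOn (fun b => if b.tail = x then b.head else b.tail) ⟨?_, ?_, ?_⟩ ?_
  · rintro b (⟨h1, h2⟩ | ⟨h1, h2⟩)
    · simp only [h1, if_true, Finset.mem_coe, mem_children]
      exact ⟨h2, h1 ▸ hadj b⟩
    · have h3 : b.tail ≠ x := fun h => (hadj b).ne (h.trans h1.symm)
      simp only [h3, if_false, Finset.mem_coe, mem_children]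
      exact ⟨h2, h1 ▸ (hadj b).symm⟩
  · rintro b (⟨h1, h2⟩ | ⟨h1, h2⟩) b' (⟨h1', h2'⟩ | ⟨h1', h2'⟩) h
    · simp only [h1, h1', if_true] at h
      exact OrientedEdge.ext_of_eq (h1.trans h1'.symm) h
    · have h3 : b'.tail ≠ x := fun h => (hadj b').ne (h.trans h1'.symm)
      simp only [h1, h3, if_true, if_false] at h
      exact (OrientedEdge.eq_of_swap (h1.trans h1'.symm) h).elim
    · have h3 : b.tail ≠ x := fun h => (hadj b).ne (h.trans h1.symm)
      simp only [h1', h3, if_true, if_false] at h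
      exact (OrientedEdge.eq_of_swap h (h1.trans h1'.symm)).elim
    · have h3 : b.tail ≠ x := fun h => (hadj b).ne (h.trans h1.symm)
      have h3' : b'.tail ≠ x := fun h => (hadj b').ne (h.trans h1'.symm)
      simp only [h3, h3', if_false] at h
      exact OrientedEdge.ext_of_eq h (h1.trans h1'.symm)
  · intro y hy
    rw [Finset.mem_coe, mem_children] at hy
    obtain ⟨b, ⟨h1, h2⟩ | ⟨h1, h2⟩⟩ := exists_edge hG ρ hy.2
    · exact ⟨b, Or.inl ⟨h1, h2 ▸ hy.1⟩, by simp [h1, h2]⟩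
    · have h3 : b.tail ≠ x := fun h => (hadj b).ne (h.trans h2.symm)
      exact ⟨b, Or.inr ⟨h2, h1 ▸ hy.1⟩, by simp only [h3, if_false]; exact h1⟩
  · rintro b (⟨h1, h2⟩ | ⟨h1, h2⟩)
    · simp only [h1, if_true]
      exact (hfg b).1 h1 h2
    · have h3 : b.tail ≠ x := fun h => (hadj b).ne (h.trans h1.symm)
      simp only [h3, if_false]
      exact (hfg b).2 h1 h2

end Volumes

/-! ### Growing volumes -/

section Growth

variable {G : SimpleGraph V} {ρ : V}

/-- The induction descends from `Λ'` to a smaller connected `Λ`, one boundary vertex at a time. An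
implication as `P` turns it into an ascending induction. -/
lemma growth_induction [DecidableEq V] {Λ' : Finset V} (hΛ' : (G.induce (Λ' : Set V)).Connected)
    {P : Finset V → Prop}
    (step : ∀ (Λ : Finset V) (x : V), (G.induce (Λ : Set V)).Connected → x ∈ outerBoundary G Λ →
      P (insert x Λ) → P Λ) (h : P Λ') {Λ : Finset V} (hΛ : (G.induce (Λ : Set V)).Connected)
    (hsub : Λ ⊆ Λ') : P Λ := by
  induction hn : (Λ' \ Λ).card generalizing Λ with
  | zero =>
    rw [Finset.card_eq_zero, Finset.sdiff_eq_empty_iff_subset] at hn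
    rwa [hsub.antisymm hn]
  | succ n ih =>
    have hne : Λ ⊂ Λ' := by
      refine Finset.ssubset_iff_subset_ne.mpr ⟨hsub, ?_⟩
      rintro rfl
      simp at hn
    obtain ⟨⟨v, hv⟩⟩ := hΛ.nonempty
    obtain ⟨x, hx', hx⟩ := exists_mem_outerBoundary ⟨v, hv⟩ hΛ' hne
    refine step Λ x hΛ hx (ih (connected_insert hΛ hx) (Finset.insert_subset hx' hsub) ?_)
    rw [Finset.sdiff_insert, Finset.card_erase_of_mem (Finset.mem_sdiff.mpr ⟨hx', hx.1⟩), hn]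
    rfl

lemma mem_of_mem_edgesMeeting {Λ : Finset V} {b : OrientedEdge G ρ}
    (hb : b ∈ edgesMeeting G ρ Λ) :
    (b.tail ∈ Λ ∨ b.tail ∈ outerBoundary G Λ) ∧ (b.head ∈ Λ ∨ b.head ∈ outerBoundary G Λ) := by
  have hadj := b.adj
  rcases hb with hb | hb
  · exact ⟨Or.inl hb, or_iff_not_imp_left.mpr fun h => ⟨h, _, hb, hadj⟩⟩
  · exact ⟨or_iff_not_imp_left.mpr fun h => ⟨h, _, hb, hadj.symm⟩, Or.inl hb⟩

lemma mem_edgesMeeting_insert [DecidableEq V] [G.LocallyFinite] {Λ : Finset V} {p x : V}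
    (hp : p ∈ Λ) {b : OrientedEdge G ρ} (hb : b ∈ edgesMeeting G ρ (insert x Λ)) :
    b ∈ edgesMeeting G ρ Λ ∨ (b.tail = x ∧ b.head ∈ children G p x) ∨
      (b.head = x ∧ b.tail ∈ children G p x) := by
  have hadj := b.adj
  simp only [mem_children]
  rcases hb with h | h <;> rcases Finset.mem_insert.mp h with h | h
  · by_cases h' : b.head = p
    · exact Or.inl (Or.inr (h' ▸ hp))
    · exact Or.inr (Or.inl ⟨h, h', h ▸ hadj⟩)
  · exact Or.inl (Or.inl h)
  · by_cases h' : b.tail = p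
    · exact Or.inl (Or.inl (h' ▸ hp))
    · exact Or.inr (Or.inr ⟨h, h', h ▸ hadj.symm⟩)
  · exact Or.inl (Or.inr h)

lemma measurableSet_cylinder [G.LocallyFinite] (hG : G.IsTree) {Λ : Finset V}
    (hΛ : (G.induce (Λ : Set V)).Connected) (ζ : GradConf G ρ) :
    MeasurableSet (cylinder Λ ζ) := by
  have : cylinder Λ ζ = ⋂ b ∈ edgesMeeting G ρ Λ, {η | η b = ζ b} := by
    ext η
    simp [mem_cylinder_iff hG hΛ]
  rw [this]
  refine MeasurableSet.biInter (finite_edgesMeeting Λ).countable fun b _ => ?_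
  exact measurableSet_eq_fun (measurable_pi_apply b) measurable_const

end Growth

/-! ### The step distribution of the height chain -/

/-- The probability that the height changes by `m` along an edge starting at height `i`. -/
def stepProb (β : ℝ) (l : ℤ → ℝ) (i m : ℤ) : ℝ := transfer β m * l (i + m) / conv β l i

lemma IsBoundaryLaw.conv_pos {k : ℕ} {β : ℝ} {l : ℤ → ℝ} (h : IsBoundaryLaw k β l) (i : ℤ) :
    0 < conv β l i := SOS.conv_pos h.1 h.2.1 i

lemma IsBoundaryLaw.stepProb_nonneg {k : ℕ} {β : ℝ} {l : ℤ → ℝ} (h : IsBoundaryLaw k β l)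
    (i m : ℤ) : 0 ≤ stepProb β l i m :=
  div_nonneg (mul_pos (transfer_pos _ _) (h.1 _)).le (h.conv_pos i).le

lemma IsBoundaryLaw.hasSum_stepProb {k : ℕ} {β : ℝ} {l : ℤ → ℝ} (h : IsBoundaryLaw k β l)
    (i : ℤ) : HasSum (stepProb β l i) 1 := by
  have h1 : HasSum (fun j => transfer β (i - j) * l j) (conv β l i) := (h.2.1 i).hasSum
  have h2 := ((Equiv.addLeft i).hasSum_iff.mpr h1).div_const (conv β l i)
  rw [div_self (h.conv_pos i).ne'] at h2
  refine h2.congr_fun fun m => ?_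
  simp only [Function.comp, Equiv.coe_addLeft, stepProb]
  rw [← transfer_neg]
  congr 3
  ring

/-- The distribution of the height increment along an edge starting at height `i`. -/
def stepLaw (β : ℝ) (l : ℤ → ℝ) (i : ℤ) : Measure ℤ :=
  Measure.sum fun m => ENNReal.ofReal (stepProb β l i m) • Measure.dirac m

lemma stepLaw_singleton (β : ℝ) (l : ℤ → ℝ) (i m : ℤ) :
    stepLaw β l i {m} = ENNReal.ofReal (stepProb β l i m) := by
  rw [stepLaw, Measure.sum_apply _ (measurableSet_singleton m), tsum_eq_single m]
  · simp
  · intro m' hm'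
    simp [hm']

lemma IsBoundaryLaw.isProbabilityMeasure {k : ℕ} {β : ℝ} {l : ℤ → ℝ} (h : IsBoundaryLaw k β l)
    (i : ℤ) : IsProbabilityMeasure (stepLaw β l i) := by
  constructor
  rw [stepLaw, Measure.sum_apply _ MeasurableSet.univ]
  simp only [Measure.smul_apply, measure_univ, smul_eq_mul, mul_one]
  rw [← ENNReal.ofReal_tsum_of_nonneg (h.stepProb_nonneg i) (h.hasSum_stepProb i).summable,
    (h.hasSum_stepProb i).tsum_eq, ENNReal.ofReal_one]

lemma tsum_pi_prod_singleton {ι : Type*} [Fintype ι] (μ : Measure ℤ) [IsProbabilityMeasure μ] :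
    ∑' τ : ι → ℤ, ∏ y, μ {τ y} = 1 := by
  have h1 : Measure.pi (fun _ : ι => μ) Set.univ = 1 := measure_univ
  have h2 : (Set.univ : Set (ι → ℤ)) = ⋃ τ : ι → ℤ, {τ} := by ext; simp
  rw [h2, measure_iUnion (fun a b hab => by simpa using hab)
    (fun τ => measurableSet_singleton τ)] at h1
  rw [← h1]
  refine tsum_congr fun τ => ?_
  rw [← Set.univ_pi_singleton, Measure.pi_pi]

/-! ### Marginals in a finite volume -/

lemma sum_range_add_of_periodic {M : Type*} [AddCommGroup M] {q : ℕ} {f : ℤ → M}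
    (hf : ∀ i, f (i + q) = f i) (m : ℤ) :
    ∑ s ∈ Finset.range q, f (s + m) = ∑ s ∈ Finset.range q, f s := by
  have step : ∀ m : ℤ, ∑ s ∈ Finset.range q, f (s + (m + 1))
      = ∑ s ∈ Finset.range q, f (s + m) := by
    intro m
    have h1 := Finset.sum_range_succ (fun s : ℕ => f (s + m)) q
    have h2 := Finset.sum_range_succ' (fun s : ℕ => f (s + m)) q
    rw [h1] at h2
    have h3 : f ((q : ℤ) + m) = f (((0 : ℕ) : ℤ) + m) := by
      rw [add_comm, hf]; simp
    rw [h3] at h2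
    rw [add_right_cancel h2]
    refine Finset.sum_congr rfl fun s _ => ?_
    congr 1
    push_cast
    ring
  induction m using Int.induction_on with
  | zero => simp
  | succ m ih => rw [step, ih]
  | pred m ih => rw [← ih, ← step]; simp

/-- The boundary factor of the marginal in the volume `Λ`. -/
def bdryFactor (G : SimpleGraph V) (q : ℕ) (l : ℤ → ℝ) (Λ : Finset V) (ω : V → ℤ) : ℝ :=
  ∑ s ∈ Finset.range q, ∏ᶠ y ∈ outerBoundary G Λ, l (s + ω y)

/-- The Boltzmann weight of a gradient configuration in the volume `Λ`. -/
def gradWeight {G : SimpleGraph V} {ρ : V} (β : ℝ) (Λ : Finset V) (ζ : GradConf G ρ) : ℝ :=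
  ∏ᶠ b ∈ edgesMeeting G ρ Λ, transfer β (ζ b)

lemma gradWeight_pos {G : SimpleGraph V} {ρ : V} (β : ℝ) (Λ : Finset V) (ζ : GradConf G ρ) :
    0 < gradWeight β Λ ζ :=
  finprod_mem_induction (0 < ·) one_pos (fun _ _ => mul_pos) fun _ _ => transfer_pos _ _

lemma finprod_mem_pos {ι : Type*} {s : Set ι} {f : ι → ℝ} (h : ∀ i, 0 < f i) :
    0 < ∏ᶠ i ∈ s, f i :=
  finprod_mem_induction (0 < ·) one_pos (fun _ _ => mul_pos) fun _ _ => h _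

/-- Summing over a full period makes the boundary factor a function of the gradient alone. -/
lemma bdryFactor_add_const {G : SimpleGraph V} {q : ℕ} {l : ℤ → ℝ}
    (hper : ∀ i, l (i + q) = l i) (Λ : Finset V) (ω : V → ℤ) (m : ℤ) :
    bdryFactor G q l Λ (fun y => ω y + m) = bdryFactor G q l Λ ω := by
  have := sum_range_add_of_periodic (q := q)
    (f := fun i : ℤ => ∏ᶠ y ∈ outerBoundary G Λ, l (i + ω y)) (fun i => by
      refine finprod_congr fun y => finprod_congr fun _ => ?_
      rw [← hper (i + ω y)]; congr 1; ring) m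
  unfold bdryFactor
  rw [← this]
  refine Finset.sum_congr rfl fun s _ => finprod_congr fun y => finprod_congr fun _ => ?_
  congr 1; ring

/-- `ν` has the marginal prescribed by `l` in the volume `Λ`. -/
def MarginalOn (G : SimpleGraph V) (ρ : V) (β : ℝ) (q : ℕ) (l : ℤ → ℝ)
    (ν : Measure (GradConf G ρ)) (Λ : Finset V) : Prop :=
  ∃ Z : ℝ, 0 < Z ∧ ∀ ω : V → ℤ, ν (cylinder Λ (grad G ρ ω))
    = ENNReal.ofReal (Z * bdryFactor G q l Λ ω * gradWeight β Λ (grad G ρ ω))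

/-- Every gradient configuration comes from a height function, unique up to a constant; this removes
the reference vertex `w` from the marginal formula. -/
lemma hasMarginals_iff {G : SimpleGraph V} (hG : G.IsTree) {ρ : V} {β : ℝ} {q : ℕ} {l : ℤ → ℝ}
    (hper : ∀ i, l (i + q) = l i) {ν : Measure (GradConf G ρ)} :
    HasMarginals hG β q l ν ↔ ∀ Λ : Finset V, (G.induce (Λ : Set V)).Connected →
      MarginalOn G ρ β q l ν Λ := by
  have key : ∀ (Λ : Finset V) (w : V) (ω : V → ℤ), ∑ s ∈ Finset.range q,
      ∏ᶠ y ∈ outerBoundary G Λ, l (heightConf hG w (s : ℤ) (grad G ρ ω) y)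
        = bdryFactor G q l Λ ω := by
    intro Λ w ω
    rw [← bdryFactor_add_const hper Λ ω (- ω w)]
    simp only [heightConf_grad, bdryFactor, sub_eq_add_neg]
  constructor
  · intro h Λ hΛ
    obtain ⟨Z, hZ, h⟩ := h Λ hΛ
    refine ⟨Z, hZ, fun ω => ?_⟩
    obtain ⟨⟨w, hw⟩⟩ := hΛ.nonempty
    rw [h w hw, key]
    rfl
  · intro h Λ hΛ
    obtain ⟨Z, hZ, h⟩ := h Λ hΛ
    refine ⟨Z, hZ, fun w hw ζ => ?_⟩
    obtain ⟨ω, rfl⟩ := exists_eq_grad hG ζ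
    rw [h ω, key]
    rfl

section Shrink

variable {G : SimpleGraph V} [G.LocallyFinite] (hG : G.IsTree) {ρ : V}

/-- `ω` with the heights at the children of `x` prescribed relative to the height at `x`. -/
def extendAt (C : Finset V) (x : V) (ω : V → ℤ) (τ : C → ℤ) : V → ℤ :=
  glue C (fun y => ω x + τ y) ω

lemma extendAt_of_mem {C : Finset V} {x : V} {ω : V → ℤ} {τ : C → ℤ} {y : V} (hy : y ∈ C) :
    extendAt C x ω τ y = ω x + τ ⟨y, hy⟩ := by simp [extendAt, glue, hy]

lemma extendAt_of_notMem {C : Finset V} {x : V} {ω : V → ℤ} {τ : C → ℤ} {y : V} (hy : y ∉ C) :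
    extendAt C x ω τ y = ω y := by simp [extendAt, glue, hy]

variable [DecidableEq V] {Λ : Finset V} (hΛ : (G.induce (Λ : Set V)).Connected) {p x : V}
  (hx : x ∉ Λ) (hp : p ∈ Λ) (hpx : G.Adj p x)

include hG hΛ hx hp hpx

lemma grad_extendAt (ω : V → ℤ) (τ : children G p x → ℤ) {b : OrientedEdge G ρ}
    (hb : b ∈ edgesMeeting G ρ Λ) :
    grad G ρ (extendAt (children G p x) x ω τ) b = grad G ρ ω b := by
  have hC : ∀ y, y ∈ Λ ∨ y ∈ outerBoundary G Λ → y ∉ children G p x := by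
    intro y hy hyC
    have := children_notMem hG hΛ hx hp hpx hyC
    tauto
  have := mem_of_mem_edgesMeeting hb
  simp only [grad]
  rw [extendAt_of_notMem (hC _ this.1), extendAt_of_notMem (hC _ this.2)]

lemma cylinder_eq_iUnion (ω : V → ℤ) :
    cylinder Λ (grad G ρ ω) = ⋃ τ : children G p x → ℤ,
      cylinder (insert x Λ) (grad G ρ (extendAt (children G p x) x ω τ)) := by
  have hxC : x ∉ children G p x := by simp [mem_children]
  have hΛ' := connected_insert hΛ (x := x) ⟨hx, p, hp, hpx⟩
  ext η
  obtain ⟨ω', rfl⟩ := exists_eq_grad hG η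
  simp only [Set.mem_iUnion, mem_cylinder_iff hG hΛ, mem_cylinder_iff hG hΛ']
  constructor
  · intro h
    refine ⟨fun y => ω' y - ω' x, fun b hb => ?_⟩
    rcases mem_edgesMeeting_insert hp hb with hb | ⟨h1, h2⟩ | ⟨h1, h2⟩
    · rw [grad_extendAt hG hΛ hx hp hpx ω _ hb, h b hb]
    · simp only [grad, h1, extendAt_of_mem h2, extendAt_of_notMem hxC]
      ring
    · simp only [grad, h1, extendAt_of_mem h2, extendAt_of_notMem hxC]
      ring
  · rintro ⟨τ, h⟩ b hb
    rw [h b (hb.imp (Finset.mem_insert_of_mem) (Finset.mem_insert_of_mem)),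
      grad_extendAt hG hΛ hx hp hpx ω _ hb]

lemma pairwise_disjoint_cylinder (ω : V → ℤ) :
    Pairwise (Function.onFun Disjoint fun τ : children G p x → ℤ =>
      cylinder (insert x Λ) (grad G ρ (extendAt (children G p x) x ω τ))) := by
  have hxC : x ∉ children G p x := by simp [mem_children]
  have hΛ' := connected_insert hΛ (x := x) ⟨hx, p, hp, hpx⟩
  intro τ τ' hne
  rw [Function.onFun, Set.disjoint_left]
  intro η h h'
  refine hne (funext fun y => ?_)
  rw [mem_cylinder_iff hG hΛ'] at h h'
  obtain ⟨b, hb⟩ := exists_edge hG ρ (mem_children.mp y.2).2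
  have hbE : b ∈ edgesMeeting G ρ (insert x Λ) := by
    rcases hb with ⟨h1, h2⟩ | ⟨h1, h2⟩
    · exact Or.inl (h1 ▸ Finset.mem_insert_self x Λ)
    · exact Or.inr (h2 ▸ Finset.mem_insert_self x Λ)
  have := (h b hbE).symm.trans (h' b hbE)
  rcases hb with ⟨h1, h2⟩ | ⟨h1, h2⟩ <;>
  · simp only [grad, h1, h2, extendAt_of_mem y.2, extendAt_of_notMem hxC] at this
    linarith

lemma gradWeight_insert (β : ℝ) (ω : V → ℤ) :
    gradWeight β (insert x Λ) (grad G ρ ω)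
      = gradWeight β Λ (grad G ρ ω) * ∏ y ∈ children G p x, transfer β (ω y - ω x) := by
  refine finprod_edgesMeeting_insert hG hΛ hx hp hpx _ (fun y => transfer β (ω y - ω x))
    fun b => ⟨fun h _ => ?_, fun h _ => ?_⟩
  · simp only [grad, h]
  · simp only [grad, h]
    rw [← transfer_neg, neg_sub]

/-- Consistency of the marginals: summing over the heights of the `k` children of `x` gives `conv ^
k` at the height of `x`, which by the boundary law equation is `l / c`. This restores the boundary
factor of `x` and changes the constant from `Z` to `Z / c`. -/
lemma marginalOn_of_insert {k : ℕ} (hreg : G.IsRegularOfDegree (k + 1)) {β : ℝ} {q : ℕ}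
    {l : ℤ → ℝ} (hl : IsBoundaryLaw k β l) {ν : Measure (GradConf G ρ)}
    (h : MarginalOn G ρ β q l ν (insert x Λ)) : MarginalOn G ρ β q l ν Λ := by
  obtain ⟨Z, hZ, h⟩ := h
  obtain ⟨hpos, -, c, hc, hlc⟩ := id hl
  have hprob := hl.isProbabilityMeasure
  have hxC : x ∉ children G p x := by simp [mem_children]
  have hΛ' := connected_insert hΛ (x := x) ⟨hx, p, hp, hpx⟩
  refine ⟨Z / c, div_pos hZ hc, fun ω => ?_⟩
  set W := gradWeight β Λ (grad G ρ ω) with hW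
  have hWpos : 0 < W := gradWeight_pos _ _ _
  set A : ℕ → ℝ := fun s => Z / c * W * ∏ᶠ y ∈ outerBoundary G Λ, l (s + ω y) with hA
  have hApos : ∀ s, 0 ≤ A s := fun s => by
    have := finprod_mem_pos (s := outerBoundary G Λ) (fun y => hpos (s + ω y))
    positivity
  -- After normalising by `conv`, the sum over `τ` is the total mass of a product of probability
  -- measures.
  have hterm : ∀ τ : children G p x → ℤ,
      ν (cylinder (insert x Λ) (grad G ρ (extendAt (children G p x) x ω τ)))
        = ∑ s ∈ Finset.range q, ENNReal.ofReal (A s) * ∏ y, stepLaw β l (s + ω x) {τ y} := by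
    intro τ
    simp only [stepLaw_singleton]
    rw [h]
    have : ∀ s : ℕ, ENNReal.ofReal (A s) * ∏ y, ENNReal.ofReal (stepProb β l (s + ω x) (τ y))
        = ENNReal.ofReal (A s * ∏ y, stepProb β l (s + ω x) (τ y)) := by
      intro s
      rw [ENNReal.ofReal_mul (hApos s),
        ENNReal.ofReal_prod_of_nonneg fun y _ => hl.stepProb_nonneg _ _]
    simp only [this]
    rw [← ENNReal.ofReal_sum_of_nonneg fun s _ => mul_nonneg (hApos s)
      (Finset.prod_nonneg fun y _ => hl.stepProb_nonneg _ _)]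
    congr 1
    rw [gradWeight_insert hG hΛ hx hp hpx]
    have hWeq : gradWeight β Λ (grad G ρ (extendAt (children G p x) x ω τ)) = W :=
      finprod_mem_congr rfl fun b hb => by rw [grad_extendAt hG hΛ hx hp hpx ω τ hb]
    rw [hWeq, bdryFactor, Finset.mul_sum, Finset.sum_mul]
    refine Finset.sum_congr rfl fun s _ => ?_
    rw [finprod_outerBoundary_insert hG hΛ hx hp hpx]
    have hB : ∏ᶠ y ∈ outerBoundary G Λ \ {x}, l (s + extendAt (children G p x) x ω τ y)
        = ∏ᶠ y ∈ outerBoundary G Λ \ {x}, l (s + ω y) := by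
      refine finprod_mem_congr rfl fun y hy => ?_
      rw [extendAt_of_notMem]
      exact fun hyC => (children_notMem hG hΛ hx hp hpx hyC).2 hy.1
    rw [hB]
    simp only [hA, finprod_outerBoundary_eq_mul hx hp hpx, extendAt_of_notMem hxC]
    rw [← Finset.prod_coe_sort (children G p x), ← Finset.prod_coe_sort (children G p x)]
    simp only [extendAt_of_mem (Subtype.coe_prop _), stepProb]
    have h1 : ∏ y : children G p x, (transfer β (τ y) * l (s + ω x + τ y) / conv β l (s + ω x))
        = (∏ y : children G p x, transfer β (τ y)) * (∏ y, l (s + ω x + τ y))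
          / conv β l (s + ω x) ^ k := by
      rw [Finset.prod_div_distrib, Finset.prod_mul_distrib, Finset.prod_const, Finset.card_univ,
        Fintype.card_coe, card_children hreg hpx]
    rw [h1]
    have h2 : l (s + ω x) = c * conv β l (s + ω x) ^ k := hlc _
    have h3 := (hl.conv_pos (s + ω x)).ne'
    rw [h2]
    simp only [add_sub_cancel_left, Subtype.coe_eta, ← add_assoc]
    field_simp
  rw [cylinder_eq_iUnion hG hΛ hx hp hpx, measure_iUnion
    (pairwise_disjoint_cylinder hG hΛ hx hp hpx ω) fun τ => measurableSet_cylinder hG hΛ' _]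
  simp only [hterm]
  rw [Summable.tsum_finsetSum fun _ _ => ENNReal.summable]
  simp only [ENNReal.tsum_mul_left, tsum_pi_prod_singleton, mul_one]
  rw [← ENNReal.ofReal_sum_of_nonneg fun s _ => hApos s]
  congr 1
  rw [bdryFactor, Finset.mul_sum, Finset.sum_mul]
  refine Finset.sum_congr rfl fun s _ => ?_
  simp only [hA]
  ring

end Shrink

/-! ### Construction of the measure associated with a periodic boundary law -/

/-- Apply the increments `ξ (d, h)` along a list of darts, starting at height `s`. -/
def runHeight {G : SimpleGraph V} (ξ : G.Dart × ℤ → ℤ) (s : ℤ) (L : List G.Dart) : ℤ :=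
  L.foldl (fun h d => h + ξ (d, h)) s

/-- The height field driven by the increments `ξ`, with height `s` at the root. -/
def chainHeight {G : SimpleGraph V} (hG : G.IsTree) (ρ : V) (s : ℤ) (ξ : G.Dart × ℤ → ℤ) (x : V) :
    ℤ :=
  runHeight ξ s (treePath hG ρ x).darts

section Chain

variable {G : SimpleGraph V} (hG : G.IsTree) {ρ : V}

lemma measurable_runHeight (s : ℤ) (L : List G.Dart) :
    Measurable fun ξ : G.Dart × ℤ → ℤ => runHeight ξ s L := by
  induction L using List.reverseRecOn with
  | nil => exact measurable_const
  | append_singleton L d ih =>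
    simp only [runHeight, List.foldl_append, List.foldl_cons, List.foldl_nil]
    -- The coordinate of `ξ` that is read depends on the current height, which takes countably many
    -- values.
    have : Measurable fun q : ℤ × (G.Dart × ℤ → ℤ) => q.1 + q.2 (d, q.1) :=
      measurable_from_prod_countable_right fun h =>
        measurable_const.add (measurable_pi_apply (d, h))
    exact this.comp (ih.prodMk measurable_id)

lemma measurable_grad_chainHeight (s : ℤ) :
    Measurable fun ξ : G.Dart × ℤ → ℤ => grad G ρ (chainHeight hG ρ s ξ) :=
  measurable_pi_lambda _ fun _ => (measurable_runHeight _ _).sub (measurable_runHeight _ _)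

lemma treePath_self (x : V) : treePath hG x x = SimpleGraph.Walk.nil :=
  (eq_treePath hG SimpleGraph.Walk.IsPath.nil).symm

lemma chainHeight_root (s : ℤ) (ξ : G.Dart × ℤ → ℤ) : chainHeight hG ρ s ξ ρ = s := by
  simp [chainHeight, treePath_self, runHeight]

/-- The dart underlying an oriented edge. -/
def OrientedEdge.dart (b : OrientedEdge G ρ) : G.Dart := ⟨(b.tail, b.head), b.adj⟩

lemma chainHeight_head (s : ℤ) (ξ : G.Dart × ℤ → ℤ) (b : OrientedEdge G ρ) :
    chainHeight hG ρ s ξ b.head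
      = chainHeight hG ρ s ξ b.tail + ξ (b.dart, chainHeight hG ρ s ξ b.tail) := by
  simp [chainHeight, treePath_head hG b, runHeight, SimpleGraph.Walk.darts_concat,
    OrientedEdge.dart]

include hG in
lemma exists_edge_of_ne_root {x : V} (hx : x ≠ ρ) : ∃ b : OrientedEdge G ρ, b.head = x := by
  obtain ⟨p, hp⟩ := hG.connected.exists_walk_length_eq_dist x ρ
  cases p with
  | nil => exact absurd rfl hx
  | @cons _ y _ h p =>
    rcases hG.dist_eq_dist_add_one_of_adj ρ h with h' | h'
    · exact ⟨⟨y, x, h.symm, h'⟩, rfl⟩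
    · exfalso
      have := SimpleGraph.dist_le p
      rw [SimpleGraph.Walk.length_cons] at hp
      rw [SimpleGraph.dist_comm, SimpleGraph.dist_comm (v := x)] at h'
      omega

/-- A volume containing the root and, with each vertex, its parent. -/
def IsRooted (G : SimpleGraph V) (ρ : V) (Λ : Finset V) : Prop :=
  ρ ∈ Λ ∧ ∀ b : OrientedEdge G ρ, b.head ∈ Λ → b.tail ∈ Λ

include hG in
lemma IsRooted.induction {Λ : Finset V} (hΛ : IsRooted G ρ Λ) {P : V → Prop} (h0 : P ρ)
    (hstep : ∀ b : OrientedEdge G ρ, b.tail ∈ Λ → P b.tail → P b.head) :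
    ∀ x ∈ Λ, P x := by
  suffices ∀ n, ∀ x ∈ Λ, G.dist ρ x = n → P x from fun x hx => this _ x hx rfl
  intro n
  induction n with
  | zero =>
    intro x _ h
    rw [(hG.connected ρ x).dist_eq_zero_iff] at h
    exact h ▸ h0
  | succ n ih =>
    intro x hx h
    have hne : x ≠ ρ := by
      rintro rfl
      simp at h
    obtain ⟨b, rfl⟩ := exists_edge_of_ne_root hG hne
    have := b.away
    exact hstep b (hΛ.2 b hx) (ih _ (hΛ.2 b hx) (by omega))

lemma IsRooted.tail_mem {Λ : Finset V} (hΛ : IsRooted G ρ Λ) {b : OrientedEdge G ρ}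
    (hb : b ∈ edgesMeeting G ρ Λ) : b.tail ∈ Λ := hb.elim id (hΛ.2 b)

/-- The chain has a prescribed gradient in a rooted volume iff the driving increments have
prescribed values. -/
lemma grad_chainHeight_mem_cylinder_iff {Λ : Finset V} (hconn : (G.induce (Λ : Set V)).Connected)
    (hΛ : IsRooted G ρ Λ) (ω : V → ℤ) (ξ : G.Dart × ℤ → ℤ) :
    grad G ρ (chainHeight hG ρ (ω ρ) ξ) ∈ cylinder Λ (grad G ρ ω) ↔
      ∀ b ∈ edgesMeeting G ρ Λ, ξ (b.dart, ω b.tail) = grad G ρ ω b := by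
  rw [mem_cylinder_iff hG hconn]
  constructor
  · intro h
    have hval : ∀ x ∈ Λ, chainHeight hG ρ (ω ρ) ξ x = ω x := by
      refine hΛ.induction hG (P := fun x => chainHeight hG ρ (ω ρ) ξ x = ω x)
        (chainHeight_root hG _ _) fun b hb hbt => ?_
      have := h b (Or.inl hb)
      simp only [grad, hbt] at this
      linarith
    intro b hb
    have h1 := h b hb
    simp only [grad, chainHeight_head, hval _ (hΛ.tail_mem hb)] at h1 ⊢
    linarith
  · intro h
    have hval : ∀ x ∈ Λ, chainHeight hG ρ (ω ρ) ξ x = ω x := by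
      refine hΛ.induction hG (P := fun x => chainHeight hG ρ (ω ρ) ξ x = ω x)
        (chainHeight_root hG _ _) fun b hb hbt => ?_
      rw [chainHeight_head, hbt, h b (Or.inl hb)]
      simp [grad]
    intro b hb
    rw [← h b hb]
    simp only [grad, chainHeight_head, hval _ (hΛ.tail_mem hb)]
    ring

/-- The law of the driving increments. -/
def driveLaw (G : SimpleGraph V) (β : ℝ) (l : ℤ → ℝ) : Measure (G.Dart × ℤ → ℤ) :=
  Measure.infinitePi fun di : G.Dart × ℤ => stepLaw β l di.2

variable {k : ℕ} {β : ℝ} {l : ℤ → ℝ} (hl : IsBoundaryLaw k β l)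

include hl

lemma isProbabilityMeasure_driveLaw : IsProbabilityMeasure (driveLaw G β l) := by
  have := hl.isProbabilityMeasure
  unfold driveLaw
  infer_instance

/-- `ξ` holds an independent increment for every pair of a dart and a starting height. On the
cylinder only the coordinates `(b.dart, ω b.tail)` are read, and these are distinct, so the
probability is a product. -/
lemma map_driveLaw_cylinder [G.LocallyFinite] {Λ : Finset V}
    (hconn : (G.induce (Λ : Set V)).Connected) (hΛ : IsRooted G ρ Λ) (ω : V → ℤ) :
    (driveLaw G β l).map (fun ξ => grad G ρ (chainHeight hG ρ (ω ρ) ξ)) (cylinder Λ (grad G ρ ω))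
      = ENNReal.ofReal (∏ᶠ b ∈ edgesMeeting G ρ Λ, stepProb β l (ω b.tail) (grad G ρ ω b)) := by
  classical
  have := hl.isProbabilityMeasure
  rw [Measure.map_apply (measurable_grad_chainHeight hG _) (measurableSet_cylinder hG hconn _)]
  set E := (finite_edgesMeeting (ρ := ρ) (G := G) Λ).toFinset with hE
  set ι : OrientedEdge G ρ → G.Dart × ℤ := fun b => (b.dart, ω b.tail) with hι
  have hinj : Function.Injective ι := by
    intro b b' h
    have h1 : b.dart = b'.dart := (Prod.ext_iff.mp h).1
    have h2 : (b.tail, b.head) = (b'.tail, b'.head) := congrArg SimpleGraph.Dart.toProd h1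
    exact OrientedEdge.ext_of_eq (Prod.ext_iff.mp h2).1 (Prod.ext_iff.mp h2).2
  have hset : (fun ξ => grad G ρ (chainHeight hG ρ (ω ρ) ξ)) ⁻¹' cylinder Λ (grad G ρ ω)
      = Set.pi (E.image ι : Finset _) fun di => {ω di.1.snd - ω di.1.fst} := by
    ext ξ
    rw [Set.mem_preimage, grad_chainHeight_mem_cylinder_iff hG hconn hΛ]
    simp only [Set.mem_pi, Finset.coe_image, Set.mem_image, Finset.mem_coe,
      Set.mem_singleton_iff, forall_exists_index, and_imp, forall_apply_eq_imp_iff₂]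
    simp only [hE, Set.Finite.mem_toFinset, hι]
    rfl
  rw [hset, driveLaw, Measure.infinitePi_pi _ fun _ _ => measurableSet_singleton _,
    Finset.prod_image fun _ _ _ _ h => hinj h,
    finprod_mem_eq_finite_toFinset_prod _ (finite_edgesMeeting Λ),
    ENNReal.ofReal_prod_of_nonneg fun _ _ => hl.stepProb_nonneg _ _]
  refine Finset.prod_congr rfl fun b _ => ?_
  rw [stepLaw_singleton]
  rfl

end Chain

/-! ### Marginals of the constructed measure -/

section Marginals

variable {G : SimpleGraph V} [G.LocallyFinite] (hG : G.IsTree) {ρ : V} {k : ℕ} {β : ℝ}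
  {l : ℤ → ℝ}

/-- The product of the step probabilities in `Λ` telescopes to the boundary factor. -/
def Telescopes (G : SimpleGraph V) (ρ : V) (k : ℕ) (β : ℝ) (l : ℤ → ℝ) (Λ : Finset V) : Prop :=
  IsRooted G ρ Λ ∧ ∃ C : ℝ, 0 < C ∧ ∀ ω : V → ℤ,
    conv β l (ω ρ) ^ (k + 1) * ∏ᶠ b ∈ edgesMeeting G ρ Λ, stepProb β l (ω b.tail) (grad G ρ ω b)
      = C * (∏ᶠ y ∈ outerBoundary G Λ, l (ω y)) * gradWeight β Λ (grad G ρ ω)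

lemma finprod_edgesMeeting_root {M : Type*} [CommMonoid M] (f : OrientedEdge G ρ → M) (g : V → M)
    (hfg : ∀ b, f b = g b.head) :
    ∏ᶠ b ∈ edgesMeeting G ρ {ρ}, f b = ∏ y ∈ G.neighborFinset ρ, g y := by
  rw [← finprod_mem_coe_finset]
  have htail : ∀ b ∈ edgesMeeting G ρ {ρ}, b.tail = ρ := by
    rintro b (h | h)
    · exact Finset.mem_singleton.mp h
    · have := b.away
      rw [Finset.mem_singleton.mp h, SimpleGraph.dist_self] at this
      omega
  refine finprod_mem_eq_of_bijOn (fun b => b.head) ⟨fun b hb => ?_, fun b hb b' hb' h => ?_,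
    fun y hy => ?_⟩ fun b _ => hfg b
  · have := b.adj
    rw [htail b hb] at this
    simpa using this
  · exact OrientedEdge.ext_of_eq ((htail b hb).trans (htail b' hb').symm) h
  · have hadj : G.Adj ρ y := by simpa using hy
    exact ⟨⟨ρ, y, hadj, by
      rw [SimpleGraph.dist_self, SimpleGraph.dist_eq_one_iff_adj.mpr hadj]⟩,
      Or.inl (Finset.mem_singleton_self ρ), rfl⟩

lemma outerBoundary_singleton (x : V) :
    outerBoundary G {x} = (G.neighborFinset x : Set V) := by
  ext y
  constructor
  · rintro ⟨-, z, hz, h⟩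
    rw [Finset.mem_singleton.mp hz] at h
    simpa using h
  · intro h
    have h : G.Adj x y := by simpa using h
    exact ⟨by simpa using h.ne', x, Finset.mem_singleton_self x, h⟩

variable (hreg : G.IsRegularOfDegree (k + 1)) (hl : IsBoundaryLaw k β l)

include hG hreg hl

-- The `k + 1` edges at the root all start at height `ω ρ`, so their denominators cancel the
-- prefactor `conv ^ (k + 1)`.
omit hG in
lemma telescopes_root : Telescopes G ρ k β l {ρ} := by
  refine ⟨⟨Finset.mem_singleton_self ρ, fun b hb => ?_⟩, 1, one_pos, fun ω => ?_⟩
  · have := b.away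
    rw [Finset.mem_singleton.mp hb, SimpleGraph.dist_self] at this
    omega
  have htail : ∀ b ∈ edgesMeeting G ρ {ρ}, b.tail = ρ := by
    rintro b (h | h)
    · exact Finset.mem_singleton.mp h
    · have := b.away
      rw [Finset.mem_singleton.mp h, SimpleGraph.dist_self] at this
      omega
  have h1 : ∏ᶠ b ∈ edgesMeeting G ρ {ρ}, stepProb β l (ω b.tail) (grad G ρ ω b)
      = ∏ y ∈ G.neighborFinset ρ, stepProb β l (ω ρ) (ω y - ω ρ) := by
    rw [← finprod_edgesMeeting_root
      (fun b : OrientedEdge G ρ => stepProb β l (ω ρ) (ω b.head - ω ρ)) _ fun _ => rfl]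
    refine finprod_mem_congr rfl fun b hb => ?_
    simp only [grad, htail b hb]
  have h2 : gradWeight β {ρ} (grad G ρ ω)
      = ∏ y ∈ G.neighborFinset ρ, transfer β (ω y - ω ρ) := by
    rw [gradWeight, ← finprod_edgesMeeting_root
      (fun b : OrientedEdge G ρ => transfer β (ω b.head - ω ρ)) _ fun _ => rfl]
    refine finprod_mem_congr rfl fun b hb => ?_
    simp only [grad, htail b hb]
  rw [h1, h2, outerBoundary_singleton, finprod_mem_coe_finset]
  simp only [stepProb, add_sub_cancel]
  rw [Finset.prod_div_distrib, Finset.prod_mul_distrib, Finset.prod_const,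
    SimpleGraph.card_neighborFinset_eq_degree, hreg ρ]
  have := (hl.conv_pos (ω ρ)).ne'
  field_simp

/-- The `k` new edges at `x` contribute the denominator `conv ^ k`, and the factor `l (ω x)` that
leaves the boundary is `c * conv ^ k`; the two cancel up to `c`. -/
lemma telescopes_insert [DecidableEq V] {Λ : Finset V} (hconn : (G.induce (Λ : Set V)).Connected)
    {x : V} (hxb : x ∈ outerBoundary G Λ) (h : Telescopes G ρ k β l Λ) :
    Telescopes G ρ k β l (insert x Λ) := by
  obtain ⟨hx, p, hp, hpx⟩ := hxb
  obtain ⟨hroot, C, hC, h⟩ := h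
  obtain ⟨hpos, -, c, hc, hlc⟩ := id hl
  -- Otherwise `x` would be the parent of `p` and would already belong to the rooted volume.
  have hparent : ∀ b : OrientedEdge G ρ, b.head = x → b.tail = p := by
    intro b hb
    obtain ⟨b', ⟨h1, h2⟩ | ⟨h1, h2⟩⟩ := exists_edge hG ρ hpx
    · rw [tail_eq_of_head_eq hG (hb.trans h2.symm), h1]
    · exact absurd (hroot.2 b' (h2 ▸ hp)) (h1 ▸ hx)
  refine ⟨⟨Finset.mem_insert_of_mem hroot.1, fun b hb => ?_⟩, C * c, mul_pos hC hc, fun ω => ?_⟩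
  · rcases Finset.mem_insert.mp hb with hb | hb
    · rw [hparent b hb]
      exact Finset.mem_insert_of_mem hp
    · exact Finset.mem_insert_of_mem (hroot.2 b hb)
  rw [finprod_edgesMeeting_insert hG hconn hx hp hpx _
    (fun y => stepProb β l (ω x) (ω y - ω x)) (fun b => ⟨fun h1 _ => by simp only [grad, h1],
      fun h1 h2 => absurd (hparent b h1) h2⟩), ← mul_assoc, h,
    finprod_outerBoundary_insert hG hconn hx hp hpx,
    gradWeight_insert hG hconn hx hp hpx, finprod_outerBoundary_eq_mul hx hp hpx]
  simp only [stepProb, add_sub_cancel]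
  rw [Finset.prod_div_distrib, Finset.prod_mul_distrib, Finset.prod_const,
    card_children hreg hpx]
  have h2 : l (ω x) = c * conv β l (ω x) ^ k := hlc _
  have h3 := (hl.conv_pos (ω x)).ne'
  rw [h2]
  field_simp

lemma telescopes_of_connected {Λ : Finset V} (hconn : (G.induce (Λ : Set V)).Connected)
    (hρ : ρ ∈ Λ) : Telescopes G ρ k β l Λ := by
  classical
  exact growth_induction (P := fun Λ₀ => Telescopes G ρ k β l Λ₀ → Telescopes G ρ k β l Λ)
    hconn (fun Λ₀ x h₀ hx hP hT => hP (telescopes_insert hG hreg hl h₀ hx hT)) id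
    (connected_singleton ρ) (by simpa using hρ) (telescopes_root hreg hl)

/-- The gradient measure of a boundary law: a mixture, over the height of the root modulo the
period, of tree-indexed Markov chains. -/
theorem exists_measure_marginalOn {q : ℕ}
    (hq : 0 < q) (hper : ∀ i, l (i + q) = l i) :
    ∃ ν : Measure (GradConf G ρ), IsProbabilityMeasure ν ∧
      ∀ Λ : Finset V, (G.induce (Λ : Set V)).Connected → MarginalOn G ρ β q l ν Λ := by
  classical
  have hprob := isProbabilityMeasure_driveLaw (G := G) hl
  -- This weight is the prefactor in `Telescopes`, so the constant becomes the same for every root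
  -- height.
  set w : ℕ → ℝ := fun s => conv β l s ^ (k + 1) with hw
  have hwpos : ∀ s, 0 < w s := fun s => pow_pos (hl.conv_pos s) _
  set T := ∑ s ∈ Finset.range q, w s with hT
  have hTpos : 0 < T := Finset.sum_pos (fun s _ => hwpos s) ⟨0, by simpa using hq⟩
  set μ : ℕ → Measure (GradConf G ρ) :=
    fun s => (driveLaw G β l).map fun ξ => grad G ρ (chainHeight hG ρ s ξ) with hμ
  have hμprob : ∀ s, IsProbabilityMeasure (μ s) := fun s =>
    Measure.isProbabilityMeasure_map (measurable_grad_chainHeight hG _).aemeasurable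
  refine ⟨∑ s ∈ Finset.range q, ENNReal.ofReal (w s / T) • μ s, ⟨?_⟩, ?_⟩
  · simp only [Measure.finsetSum_apply, Measure.smul_apply, measure_univ, smul_eq_mul, mul_one]
    rw [← ENNReal.ofReal_sum_of_nonneg fun s _ => (div_pos (hwpos s) hTpos).le,
      ← Finset.sum_div, div_self hTpos.ne', ENNReal.ofReal_one]
  have hrooted : ∀ Λ : Finset V, (G.induce (Λ : Set V)).Connected → ρ ∈ Λ →
      MarginalOn G ρ β q l (∑ s ∈ Finset.range q, ENNReal.ofReal (w s / T) • μ s) Λ := by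
    intro Λ hconn hρ
    obtain ⟨hroot, C, hC, h⟩ := telescopes_of_connected hG hreg hl hconn hρ
    refine ⟨C / T, div_pos hC hTpos, fun ω => ?_⟩
    rw [← bdryFactor_add_const hper Λ ω (- ω ρ), bdryFactor, Finset.mul_sum, Finset.sum_mul,
      ENNReal.ofReal_sum_of_nonneg]
    · simp only [Measure.finsetSum_apply, Measure.smul_apply, smul_eq_mul]
      refine Finset.sum_congr rfl fun s _ => ?_
      set ω' : V → ℤ := fun y => s + (ω y + -ω ρ) with hω'
      have hgrad : grad G ρ ω = grad G ρ ω' := by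
        ext b; simp [grad, hω']
      have hωρ : ω' ρ = s := by simp [hω']
      have h1 := map_driveLaw_cylinder hG hl hconn hroot ω'
      rw [hωρ] at h1
      rw [hgrad]
      simp only [hμ]
      rw [h1, ← ENNReal.ofReal_mul (div_pos (hwpos s) hTpos).le]
      congr 1
      have h2 := h ω'
      rw [hωρ] at h2
      change w s * _ = _ at h2
      rw [div_mul_eq_mul_div, h2]
      ring
    · intro s _
      have h1 := finprod_mem_pos (s := outerBoundary G Λ) (fun y => hl.1 (s + (ω y + -ω ρ)))
      have h2 := gradWeight_pos β Λ (grad G ρ ω)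
      positivity
  intro Λ hconn
  -- A volume without the root is reached by shrinking a connected volume that contains it.
  obtain ⟨Λ', hsub, hconn'⟩ := SimpleGraph.extend_finset_to_connected hG.connected.preconnected
    (t := insert ρ Λ) ⟨ρ, Finset.mem_insert_self ρ Λ⟩
  refine growth_induction hconn' (fun Λ₀ x h₀ hx hP => ?_)
    (hrooted Λ' hconn' (hsub (Finset.mem_insert_self ρ Λ))) hconn
    ((Finset.subset_insert ρ Λ).trans hsub)
  obtain ⟨hx, p, hp, hpx⟩ := hx
  exact marginalOn_of_insert hG h₀ hx hp hpx hreg hl hP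

end Marginals

/-! ### Cylinders determine the measure -/

section Uniqueness

variable {G : SimpleGraph V} [G.LocallyFinite] (hG : G.IsTree) {ρ : V}

include hG

/-- Cylinders are the preimages of single points in a countable space. The factor `r` permits two
different normalising constants. -/
lemma map_restrict_eq_of_cylinder {Λ : Finset V} (hΛ : (G.induce (Λ : Set V)).Connected)
    {μ ν : Measure (GradConf G ρ)} {r : ENNReal}
    (h : ∀ ζ : GradConf G ρ, μ (cylinder Λ ζ) = r * ν (cylinder Λ ζ)) :
    μ.map (finite_edgesMeeting (ρ := ρ) (G := G) Λ).toFinset.restrict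
      = r • ν.map (finite_edgesMeeting (ρ := ρ) (G := G) Λ).toFinset.restrict := by
  classical
  set E := (finite_edgesMeeting (ρ := ρ) (G := G) Λ).toFinset with hE
  have hmeas : Measurable (E.restrict : GradConf G ρ → (E → ℤ)) :=
    Finset.measurable_restrict E
  refine Measure.ext_of_singleton fun a => ?_
  rw [Measure.smul_apply, smul_eq_mul, Measure.map_apply hmeas (measurableSet_singleton a),
    Measure.map_apply hmeas (measurableSet_singleton a)]
  have hset : (E.restrict : GradConf G ρ → (E → ℤ)) ⁻¹' {a}
      = cylinder Λ fun b => if hb : b ∈ E then a ⟨b, hb⟩ else 0 := by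
    ext η
    rw [Set.mem_preimage, Set.mem_singleton_iff, mem_cylinder_iff hG hΛ, funext_iff]
    constructor
    · intro h b hb
      have hbE : b ∈ E := by simpa [hE] using hb
      rw [dif_pos hbE]
      exact h ⟨b, hbE⟩
    · intro h b
      have hb : b.1 ∈ edgesMeeting G ρ Λ :=
        (Set.Finite.mem_toFinset _).mp b.2
      have := h b.1 hb
      rw [dif_pos b.2] at this
      exact this
  rw [hset, h]

/-- Any finite set of edges meets some connected volume containing `Λ₀`, so large volumes determine
all finite-dimensional marginals. -/
lemma ext_of_cylinder (Λ₀ : Finset V) {μ ν : Measure (GradConf G ρ)} [IsFiniteMeasure ν]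
    (h : ∀ Λ : Finset V, Λ₀ ⊆ Λ → (G.induce (Λ : Set V)).Connected →
      ∀ ζ : GradConf G ρ, μ (cylinder Λ ζ) = ν (cylinder Λ ζ)) : μ = ν := by
  classical
  refine IsProjectiveLimit.unique (P := fun I : Finset (OrientedEdge G ρ) => ν.map I.restrict)
    (fun I => ?_) (fun I => rfl)
  change μ.map I.restrict = ν.map I.restrict
  obtain ⟨Λ, hsub, hΛ⟩ := SimpleGraph.extend_finset_to_connected hG.connected.preconnected
    (t := insert ρ (Λ₀ ∪ I.image OrientedEdge.tail)) ⟨ρ, Finset.mem_insert_self _ _⟩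
  have hmap := map_restrict_eq_of_cylinder hG hΛ (μ := μ) (ν := ν) (r := 1) (fun ζ => by
    rw [one_mul]
    exact h Λ ((Finset.subset_union_left.trans (Finset.subset_insert _ _)).trans hsub) hΛ ζ)
  rw [one_smul] at hmap
  set E := (finite_edgesMeeting (ρ := ρ) (G := G) Λ).toFinset with hE
  have hIE : I ⊆ E := by
    intro b hb
    rw [hE, Set.Finite.mem_toFinset]
    exact Or.inl (hsub (Finset.mem_insert_of_mem
      (Finset.mem_union_right _ (Finset.mem_image_of_mem _ hb))))
  have hcomp : (I.restrict : GradConf G ρ → (I → ℤ))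
      = Finset.restrict₂ (π := fun _ => ℤ) hIE ∘ E.restrict := rfl
  rw [hcomp, ← Measure.map_map (Finset.measurable_restrict₂ hIE) (Finset.measurable_restrict E),
    ← Measure.map_map (Finset.measurable_restrict₂ hIE) (Finset.measurable_restrict E), hmap]

/-- Equal boundary laws leave only the ratio of the constants `Z` open, and total mass one fixes it.
-/
lemma MarginalOn.eq_of_isProbabilityMeasure {β : ℝ} {q : ℕ} {l : ℤ → ℝ}
    {μ ν : Measure (GradConf G ρ)} [IsProbabilityMeasure μ] [IsProbabilityMeasure ν]
    (hμ : ∀ Λ : Finset V, (G.induce (Λ : Set V)).Connected → MarginalOn G ρ β q l μ Λ)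
    (hν : ∀ Λ : Finset V, (G.induce (Λ : Set V)).Connected → MarginalOn G ρ β q l ν Λ) :
    μ = ν := by
  refine ext_of_cylinder hG ∅ fun Λ _ hΛ => ?_
  obtain ⟨Z, hZ, h⟩ := hμ Λ hΛ
  obtain ⟨Z', hZ', h'⟩ := hν Λ hΛ
  have hr : ∀ ζ : GradConf G ρ,
      μ (cylinder Λ ζ) = ENNReal.ofReal (Z / Z') * ν (cylinder Λ ζ) := by
    intro ζ
    obtain ⟨ω, rfl⟩ := exists_eq_grad hG ζ
    rw [h, h', ← ENNReal.ofReal_mul (div_pos hZ hZ').le]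
    congr 1
    field_simp
  have hmap := congrArg (fun m => m Set.univ) (map_restrict_eq_of_cylinder hG hΛ hr)
  simp only [Measure.smul_apply, smul_eq_mul] at hmap
  rw [Measure.map_apply (Finset.measurable_restrict _) MeasurableSet.univ,
    Measure.map_apply (Finset.measurable_restrict _) MeasurableSet.univ, Set.preimage_univ,
    measure_univ, measure_univ, mul_one] at hmap
  intro ζ
  rw [hr, ← hmap, one_mul]

end Uniqueness

/-! ### The DLR equation -/

section DLR

variable {G : SimpleGraph V} {ρ : V}

/-- The gradient configuration obtained by changing the heights in `Λ` by `φ`. -/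
def shiftConf (Λ : Finset V) (φ : Λ → ℤ) (ζ : GradConf G ρ) : GradConf G ρ :=
  ζ + grad G ρ (glue Λ φ 0)

lemma shiftConf_shiftConf (Λ : Finset V) (φ ψ : Λ → ℤ) (ζ : GradConf G ρ) :
    shiftConf Λ φ (shiftConf Λ ψ ζ) = shiftConf Λ (φ + ψ) ζ := by
  ext b
  simp only [shiftConf, grad, glue, Pi.add_apply, Pi.zero_apply]
  split_ifs <;> ring

lemma shiftConf_zero (Λ : Finset V) (ζ : GradConf G ρ) : shiftConf Λ 0 ζ = ζ := by
  ext b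
  simp [shiftConf, grad, glue]

lemma measurable_shiftConf (Λ : Finset V) (φ : Λ → ℤ) :
    Measurable (shiftConf (G := G) (ρ := ρ) Λ φ) := measurable_id.add_const _

lemma shiftConf_grad (Λ : Finset V) (φ : Λ → ℤ) (ω : V → ℤ) :
    shiftConf Λ φ (grad G ρ ω) = grad G ρ (fun x => ω x + glue Λ φ 0 x) := by
  ext b
  simp only [shiftConf, grad, Pi.add_apply]
  ring

lemma shiftConf_mem_cylinder_iff (Λ B : Finset V) (φ : Λ → ℤ) (η ζ : GradConf G ρ) :
    shiftConf Λ φ η ∈ cylinder B (shiftConf Λ φ ζ) ↔ η ∈ cylinder B ζ := by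
  simp [cylinder, shiftConf]

/-- The Boltzmann weight as an extended nonnegative number. -/
def eWeight (β : ℝ) (Λ : Finset V) (ζ : GradConf G ρ) : ENNReal :=
  ENNReal.ofReal (gradWeight β Λ ζ)

lemma eWeight_ne_zero (β : ℝ) (Λ : Finset V) (ζ : GradConf G ρ) : eWeight β Λ ζ ≠ 0 := by
  simpa [eWeight] using gradWeight_pos β Λ ζ

lemma eWeight_ne_top (β : ℝ) (Λ : Finset V) (ζ : GradConf G ρ) : eWeight β Λ ζ ≠ ⊤ :=
  ENNReal.ofReal_ne_top

lemma gradWeight_congr {β : ℝ} {Λ : Finset V} {η ζ : GradConf G ρ}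
    (h : ∀ b ∈ edgesMeeting G ρ Λ, η b = ζ b) : gradWeight β Λ η = gradWeight β Λ ζ :=
  finprod_mem_congr rfl fun b hb => by rw [h b hb]

lemma edgesMeeting_mono {Λ B : Finset V} (h : Λ ⊆ B) : edgesMeeting G ρ Λ ⊆ edgesMeeting G ρ B :=
  fun _ hb => hb.imp (fun hb => h hb) fun hb => h hb

variable [G.LocallyFinite]

lemma measurable_eWeight (β : ℝ) (Λ : Finset V) :
    Measurable (eWeight (G := G) (ρ := ρ) β Λ) := by
  unfold eWeight gradWeight
  simp only [finprod_mem_eq_finite_toFinset_prod _ (finite_edgesMeeting (ρ := ρ) (G := G) Λ)]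
  refine ENNReal.measurable_ofReal.comp (Finset.measurable_fun_prod _ fun b _ => ?_)
  exact (measurable_of_countable (transfer β)).comp (measurable_pi_apply b)

/-- Edges that miss `Λ` keep their gradients, so the ratio of weights in `B` equals the ratio in
`Λ`; it is stated without division. -/
lemma gradWeight_shiftConf {Λ B : Finset V} (h : Λ ⊆ B) (β : ℝ) (φ : Λ → ℤ) (ζ : GradConf G ρ) :
    gradWeight β B (shiftConf Λ φ ζ) * gradWeight β Λ ζ
      = gradWeight β B ζ * gradWeight β Λ (shiftConf Λ φ ζ) := by
  have hsplit : ∀ η : GradConf G ρ, gradWeight β B η = gradWeight β Λ η *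
      ∏ᶠ b ∈ edgesMeeting G ρ B \ edgesMeeting G ρ Λ, transfer β (η b) := fun η =>
    (finprod_mem_mul_sdiff (edgesMeeting_mono h) (finite_edgesMeeting B)).symm
  have hout : ∏ᶠ b ∈ edgesMeeting G ρ B \ edgesMeeting G ρ Λ, transfer β (shiftConf Λ φ ζ b)
      = ∏ᶠ b ∈ edgesMeeting G ρ B \ edgesMeeting G ρ Λ, transfer β (ζ b) := by
    refine finprod_mem_congr rfl fun b hb => ?_
    have h1 : b.tail ∉ Λ := fun h => hb.2 (Or.inl h)
    have h2 : b.head ∉ Λ := fun h => hb.2 (Or.inr h)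
    simp [shiftConf, grad, glue, h1, h2]
  rw [hsplit, hsplit ζ, hout]
  ring

variable (hG : G.IsTree) {β : ℝ} {q : ℕ} {l : ℤ → ℝ} {ν : Measure (GradConf G ρ)}

-- Heights on the boundary of `B` are untouched by a change inside `Λ ⊆ B`, so constant and boundary
-- factor cancel.
include hG in
lemma measure_cylinder_shiftConf {Λ B : Finset V} (h : Λ ⊆ B) (hB : MarginalOn G ρ β q l ν B)
    (hpos : ∀ i, 0 < l i) (φ : Λ → ℤ) (ζ : GradConf G ρ) :
    ν (cylinder B (shiftConf Λ φ ζ)) * eWeight β Λ ζ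
      = ν (cylinder B ζ) * eWeight β Λ (shiftConf Λ φ ζ) := by
  obtain ⟨Z, hZ, hB⟩ := hB
  obtain ⟨ω, rfl⟩ := exists_eq_grad hG ζ
  have hw := gradWeight_shiftConf h β φ (grad G ρ ω)
  rw [shiftConf_grad] at hw ⊢
  have hbf : bdryFactor G q l B (fun x => ω x + glue Λ φ 0 x) = bdryFactor G q l B ω := by
    refine Finset.sum_congr rfl fun s _ => finprod_mem_congr rfl fun y hy => ?_
    have : y ∉ Λ := fun hy' => hy.1 (h hy')
    simp [glue, this]
  have hnn : 0 ≤ bdryFactor G q l B ω :=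
    Finset.sum_nonneg fun s _ => (finprod_mem_pos fun y => hpos _).le
  rw [hB, hB, hbf, eWeight, eWeight, ← ENNReal.ofReal_mul, ← ENNReal.ofReal_mul, mul_assoc, hw]
  · congr 1; ring
  · exact mul_nonneg (mul_nonneg hZ.le hnn) (gradWeight_pos _ _ _).le
  · exact mul_nonneg (mul_nonneg hZ.le hnn) (gradWeight_pos _ _ _).le

include hG in
/-- The measure is quasi-invariant under a change of finitely many heights. -/
lemma lintegral_shiftConf [IsProbabilityMeasure ν] (hpos : ∀ i, 0 < l i)
    (hν : ∀ Λ : Finset V, (G.induce (Λ : Set V)).Connected → MarginalOn G ρ β q l ν Λ)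
    (Λ : Finset V) (φ : Λ → ℤ) {f : GradConf G ρ → ENNReal} (hf : Measurable f) :
    ∫⁻ η, eWeight β Λ (shiftConf Λ φ η) / eWeight β Λ η * f (shiftConf Λ φ η) ∂ν
      = ∫⁻ η, f η ∂ν := by
  set D : GradConf G ρ → ENNReal := fun η => eWeight β Λ (shiftConf Λ φ η) / eWeight β Λ η with hD
  have hDm : Measurable D :=
    ((measurable_eWeight β Λ).comp (measurable_shiftConf Λ φ)).div (measurable_eWeight β Λ)
  have hS := measurable_shiftConf (G := G) (ρ := ρ) Λ φ
  -- It suffices to test cylinders over connected `B ⊇ Λ`, on which the density `D` is constant.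
  have hmain : (ν.withDensity D).map (shiftConf Λ φ) = ν := by
    refine ext_of_cylinder hG Λ fun B hΛB hB ζ => ?_
    have hcyl := measurableSet_cylinder (ρ := ρ) hG hB
    obtain ⟨ζ', rfl⟩ : ∃ ζ', ζ = shiftConf Λ φ ζ' :=
      ⟨shiftConf Λ (-φ) ζ, by rw [shiftConf_shiftConf, add_neg_cancel, shiftConf_zero]⟩
    have hpre : shiftConf Λ φ ⁻¹' cylinder B (shiftConf Λ φ ζ') = cylinder B ζ' := by
      ext η
      exact shiftConf_mem_cylinder_iff Λ B φ η ζ'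
    rw [Measure.map_apply hS (hcyl _), hpre, withDensity_apply _ (hcyl _)]
    have hconst : ∀ η ∈ cylinder B ζ', D η = D ζ' := by
      intro η hη
      rw [mem_cylinder_iff hG hB] at hη
      have hη' : ∀ b ∈ edgesMeeting G ρ Λ, η b = ζ' b := fun b hb =>
        hη b (edgesMeeting_mono hΛB hb)
      simp only [hD, eWeight]
      rw [gradWeight_congr hη', gradWeight_congr (η := shiftConf Λ φ η) (ζ := shiftConf Λ φ ζ')
        fun b hb => by simp only [shiftConf, Pi.add_apply, hη' b hb]]
    rw [setLIntegral_congr_fun (hcyl _) hconst, setLIntegral_const]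
    have h1 := measure_cylinder_shiftConf hG hΛB (hν B hB) hpos φ ζ'
    have h2 := eWeight_ne_zero β Λ ζ'
    have h3 := eWeight_ne_top β Λ ζ'
    simp only [hD]
    rw [div_eq_mul_inv, mul_right_comm, mul_comm (eWeight β Λ (shiftConf Λ φ ζ')), ← h1,
      mul_assoc, ENNReal.mul_inv_cancel h2 h3, mul_one]
  conv_rhs => rw [← hmain]
  rw [lintegral_map hf hS]
  exact (lintegral_withDensity_eq_lintegral_mul _ hDm (hf.comp hS)).symm

/-- The partition function in `Λ` as a function of the gradient boundary condition. -/
def partition (β : ℝ) (Λ : Finset V) (ζ : GradConf G ρ) : ENNReal :=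
  ∑' φ : Λ → ℤ, eWeight β Λ (shiftConf Λ φ ζ)

omit [G.LocallyFinite] in
lemma partition_shiftConf (Λ : Finset V) (φ : Λ → ℤ) (ζ : GradConf G ρ) :
    partition β Λ (shiftConf Λ φ ζ) = partition β Λ ζ := by
  unfold partition
  simp only [shiftConf_shiftConf]
  exact (Equiv.addRight φ).tsum_eq fun ψ => eWeight β Λ (shiftConf Λ ψ ζ)

omit [G.LocallyFinite] in
lemma partition_ne_zero (Λ : Finset V) (ζ : GradConf G ρ) : partition β Λ ζ ≠ 0 := by
  intro h
  exact eWeight_ne_zero β Λ _ (ENNReal.tsum_eq_zero.mp h 0)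

lemma measurable_partition (Λ : Finset V) : Measurable (partition (G := G) (ρ := ρ) β Λ) :=
  Measurable.tsum fun φ => (measurable_eWeight β Λ).comp (measurable_shiftConf Λ φ)

lemma exp_hamiltonian (β : ℝ) (Λ : Finset V) (ω : V → ℤ) :
    Real.exp (-β * hamiltonian G ρ Λ ω) = gradWeight β Λ (grad G ρ ω) := by
  have hfin := finite_edgesMeeting (ρ := ρ) (G := G) Λ
  rw [hamiltonian, gradWeight, finsum_mem_eq_finite_toFinset_sum _ hfin,
    finprod_mem_eq_finite_toFinset_prod _ hfin, Finset.mul_sum, Real.exp_sum]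
  rfl

omit [G.LocallyFinite] in
lemma measurable_grad : Measurable (grad G ρ) :=
  measurable_pi_lambda _ fun _ => (measurable_pi_apply _).sub (measurable_pi_apply _)

lemma boltzmann_map_grad_apply (Λ : Finset V) (ω : V → ℤ) {A : Set (GradConf G ρ)}
    (hA : MeasurableSet A) : boltzmann G ρ β Λ ω (grad G ρ ⁻¹' A)
      = ∑' φ : Λ → ℤ, eWeight β Λ (shiftConf Λ φ (grad G ρ ω))
          * A.indicator 1 (shiftConf Λ φ (grad G ρ ω)) := by
  rw [boltzmann, Measure.sum_apply _ (measurable_grad hA)]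
  -- Heights in `Λ` are reindexed by their deviation `φ` from the reference heights `ω`.
  rw [← (Equiv.addRight fun x : Λ => ω x).tsum_eq]
  refine tsum_congr fun φ => ?_
  have hglue : grad G ρ (glue Λ ((Equiv.addRight fun x : Λ => ω x) φ) ω)
      = shiftConf Λ φ (grad G ρ ω) := by
    rw [shiftConf_grad]
    congr 1
    ext x
    simp only [glue, Equiv.coe_addRight, Pi.add_apply, Pi.zero_apply]
    split_ifs <;> ring
  rw [Measure.smul_apply, smul_eq_mul, Measure.dirac_apply' _ (measurable_grad hA),
    exp_hamiltonian, hglue]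
  congr 1
  rw [← hglue]
  rfl

lemma gradSpec_apply (Λ : Finset V) (ζ : GradConf G ρ) {A : Set (GradConf G ρ)}
    (hA : MeasurableSet A) : gradSpec hG β Λ ζ A = (partition β Λ ζ)⁻¹ *
      ∑' φ : Λ → ℤ, eWeight β Λ (shiftConf Λ φ ζ) * A.indicator 1 (shiftConf Λ φ ζ) := by
  rw [gradSpec, gibbsSpec, Measure.map_apply measurable_grad hA, Measure.smul_apply, smul_eq_mul,
    boltzmann_map_grad_apply _ _ hA, ← Set.preimage_univ (f := grad G ρ),
    boltzmann_map_grad_apply _ _ MeasurableSet.univ, grad_heightConf]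
  simp [partition]

include hG in
/-- The complement of a finite volume is nonempty. -/
lemma exists_notMem {k : ℕ} (hk : 1 ≤ k) (hreg : G.IsRegularOfDegree (k + 1)) (Λ : Finset V)
    (ρ : V) : ∃ v, v ∉ Λ := by
  classical
  by_contra! hall
  -- In a finite tree all neighbours of a vertex farthest from the root would be its parent, but
  -- there are at least two.
  obtain ⟨x, -, hmax⟩ := Finset.exists_max_image Λ (fun x => G.dist ρ x) ⟨ρ, hall ρ⟩
  have hcard : 1 < (G.neighborFinset x).card := by
    rw [SimpleGraph.card_neighborFinset_eq_degree, hreg x]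
    omega
  obtain ⟨y, hy, z, hz, hyz⟩ := Finset.one_lt_card.mp hcard
  rw [SimpleGraph.mem_neighborFinset] at hy hz
  have hedge : ∀ y, G.Adj x y → ∃ b : OrientedEdge G ρ, b.head = x ∧ b.tail = y := by
    intro y hy
    rcases hG.dist_eq_dist_add_one_of_adj ρ hy with h | h
    · exact ⟨⟨y, x, hy.symm, h⟩, rfl, rfl⟩
    · have := hmax y (hall y)
      omega
  obtain ⟨b, hb, rfl⟩ := hedge y hy
  obtain ⟨b', hb', rfl⟩ := hedge z hz
  exact hyz (tail_eq_of_head_eq hG (hb.trans hb'.symm))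

variable {k : ℕ} (hk : 1 ≤ k) (hreg : G.IsRegularOfDegree (k + 1)) (hq : 0 < q)
  (hpos : ∀ i, 0 < l i) [IsProbabilityMeasure ν]
  (hν : ∀ Λ : Finset V, (G.induce (Λ : Set V)).Connected → MarginalOn G ρ β q l ν Λ)

include hG hk hreg hq hpos hν

/-- Finiteness comes from `ν`: the shifted cylinders are disjoint, so their masses sum to at most
one, and these masses are proportional to the weights in the partition sum. A vertex `v` of `B`
outside `Λ` pins the heights, so distinct `φ` give distinct gradients. -/
lemma partition_ne_top (Λ : Finset V) (ζ : GradConf G ρ) : partition β Λ ζ ≠ ⊤ := by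
  classical
  obtain ⟨v, hv⟩ := exists_notMem hG hk hreg Λ ρ
  obtain ⟨B, hsub, hB⟩ := SimpleGraph.extend_finset_to_connected hG.connected.preconnected
    (t := insert v Λ) ⟨v, Finset.mem_insert_self v Λ⟩
  have hvB : v ∈ B := hsub (Finset.mem_insert_self v Λ)
  have hΛB : Λ ⊆ B := (Finset.subset_insert v Λ).trans hsub
  have hdisj : Pairwise (Function.onFun Disjoint fun φ : Λ → ℤ =>
      cylinder B (shiftConf Λ φ ζ)) := by
    intro φ ψ hne
    rw [Function.onFun, Set.disjoint_left]
    intro η h h'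
    rw [mem_cylinder_iff hG hB] at h h'
    refine hne (funext fun x => ?_)
    set δ : V → ℤ := fun y => glue Λ φ 0 y - glue Λ ψ 0 y with hδ
    have hgrad : ∀ b ∈ edgesMeeting G ρ B, δ b.head = δ b.tail := by
      intro b hb
      have := (h b hb).symm.trans (h' b hb)
      simp only [shiftConf, Pi.add_apply, grad] at this
      simp only [hδ]
      linarith
    have hadj : ∀ y z, G.Adj y z → y ∈ B → δ y = δ z := by
      intro y z hyz hy
      obtain ⟨b, ⟨h1, h2⟩ | ⟨h1, h2⟩⟩ := exists_edge hG ρ hyz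
      · rw [← h1, ← h2, hgrad b (Or.inl (h1 ▸ hy))]
      · rw [← h1, ← h2, hgrad b (Or.inr (h2 ▸ hy))]
    have hwalk : ∀ {y z : V} (p : G.Walk y z), (∀ w ∈ p.support, w ∈ B) → δ y = δ z := by
      intro y z p
      induction p with
      | nil => intro _; rfl
      | cons h p ih =>
        intro hs
        rw [SimpleGraph.Walk.support_cons] at hs
        rw [hadj _ _ h (hs _ List.mem_cons_self)]
        exact ih fun w hw => hs w (List.mem_cons_of_mem _ hw)
    obtain ⟨p, -, hp⟩ := exists_path_of_connected hB (hΛB x.2) hvB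
    have := hwalk p hp
    simp only [hδ, glue, x.2, hv, dif_pos, dif_neg, not_false_eq_true, Pi.zero_apply,
      Subtype.coe_eta, sub_self] at this
    linarith
  have hsum : ∑' φ : Λ → ℤ, ν (cylinder B (shiftConf Λ φ ζ)) ≤ 1 := by
    rw [← measure_iUnion hdisj fun φ => measurableSet_cylinder hG hB _]
    exact prob_le_one
  have hcyl : ν (cylinder B ζ) ≠ 0 := by
    obtain ⟨Z, hZ, h⟩ := hν B hB
    obtain ⟨ω, rfl⟩ := exists_eq_grad hG ζ
    rw [h]
    have h1 : 0 < bdryFactor G q l B ω :=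
      Finset.sum_pos (fun s _ => finprod_mem_pos fun y => hpos _) ⟨0, by simpa using hq⟩
    have h2 := gradWeight_pos β B (grad G ρ ω)
    simp only [ne_eq, ENNReal.ofReal_eq_zero, not_le]
    positivity
  intro htop
  have h1 : ν (cylinder B ζ) * partition β Λ ζ ≤ eWeight β Λ ζ := by
    rw [partition, ← ENNReal.tsum_mul_left]
    calc ∑' φ : Λ → ℤ, ν (cylinder B ζ) * eWeight β Λ (shiftConf Λ φ ζ)
        = ∑' φ : Λ → ℤ, ν (cylinder B (shiftConf Λ φ ζ)) * eWeight β Λ ζ :=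
          tsum_congr fun φ => (measure_cylinder_shiftConf hG hΛB (hν B hB) hpos φ ζ).symm
      _ = (∑' φ : Λ → ℤ, ν (cylinder B (shiftConf Λ φ ζ))) * eWeight β Λ ζ :=
          ENNReal.tsum_mul_right
      _ ≤ 1 * eWeight β Λ ζ := by gcongr
      _ = eWeight β Λ ζ := one_mul _
  rw [htop, ENNReal.mul_top hcyl] at h1
  exact eWeight_ne_top β Λ ζ (top_le_iff.mp h1)

omit hk hreg hq hpos hν in
omit [IsProbabilityMeasure ν] in
lemma measurable_gradSpec (Λ : Finset V) : Measurable (gradSpec (ρ := ρ) hG β Λ) := by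
  refine Measure.measurable_of_measurable_coe _ fun A hA => ?_
  simp only [gradSpec_apply hG Λ _ hA]
  refine (measurable_partition Λ).inv.mul (Measurable.tsum fun φ => ?_)
  exact ((measurable_eWeight β Λ).comp (measurable_shiftConf Λ φ)).mul
    ((measurable_one.indicator hA).comp (measurable_shiftConf Λ φ))

lemma isProbabilityMeasure_gradSpec (Λ : Finset V) (ζ : GradConf G ρ) :
    IsProbabilityMeasure (gradSpec hG β Λ ζ) := by
  constructor
  rw [gradSpec_apply hG Λ ζ MeasurableSet.univ]
  simp only [Set.indicator_univ, Pi.one_apply, mul_one]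
  exact ENNReal.inv_mul_cancel (partition_ne_zero Λ ζ)
    (partition_ne_top hG hk hreg hq hpos hν Λ ζ)

/-- Quasi-invariance moves each term of the specification back to an unshifted `A`; the remaining
weights sum to the partition function, which cancels. -/
lemma lintegral_gradSpec (Λ : Finset V) {A : Set (GradConf G ρ)} (hA : MeasurableSet A) :
    ∫⁻ ζ, gradSpec hG β Λ ζ A ∂ν = ν A := by
  have hind : Measurable (A.indicator (1 : GradConf G ρ → ENNReal)) := measurable_one.indicator hA
  have hS := fun φ : Λ → ℤ => measurable_shiftConf (G := G) (ρ := ρ) Λ φ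
  have hE := measurable_eWeight (G := G) (ρ := ρ) β Λ
  have hP := measurable_partition (G := G) (ρ := ρ) (β := β) Λ
  set f : (Λ → ℤ) → GradConf G ρ → ENNReal := fun φ η =>
    (partition β Λ η)⁻¹ * eWeight β Λ (shiftConf Λ (-φ) η) * A.indicator 1 η with hf
  have hfm : ∀ φ, Measurable (f φ) := fun φ => (hP.inv.mul (hE.comp (hS _))).mul hind
  calc ∫⁻ ζ, gradSpec hG β Λ ζ A ∂ν
      = ∫⁻ ζ, ∑' φ : Λ → ℤ, eWeight β Λ (shiftConf Λ φ ζ) / eWeight β Λ ζ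
          * f φ (shiftConf Λ φ ζ) ∂ν := by
        refine lintegral_congr fun ζ => ?_
        rw [gradSpec_apply hG Λ ζ hA, ← ENNReal.tsum_mul_left]
        refine tsum_congr fun φ => ?_
        simp only [hf]
        rw [partition_shiftConf, shiftConf_shiftConf, neg_add_cancel, shiftConf_zero,
          div_eq_mul_inv]
        have h2 := ENNReal.mul_inv_cancel (eWeight_ne_zero β Λ ζ) (eWeight_ne_top β Λ ζ)
        calc _ = (partition β Λ ζ)⁻¹ * (eWeight β Λ (shiftConf Λ φ ζ)
              * A.indicator 1 (shiftConf Λ φ ζ)) * 1 := (mul_one _).symm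
          _ = _ := by rw [← h2]; ring
    _ = ∑' φ : Λ → ℤ, ∫⁻ ζ, eWeight β Λ (shiftConf Λ φ ζ) / eWeight β Λ ζ
          * f φ (shiftConf Λ φ ζ) ∂ν :=
        lintegral_tsum fun φ => (((hE.comp (hS φ)).div hE).mul
          ((hfm φ).comp (hS φ))).aemeasurable
    _ = ∑' φ : Λ → ℤ, ∫⁻ η, f φ η ∂ν :=
        tsum_congr fun φ => lintegral_shiftConf hG hpos hν Λ φ (hfm φ)
    _ = ∫⁻ η, ∑' φ : Λ → ℤ, f φ η ∂ν := (lintegral_tsum fun φ => (hfm φ).aemeasurable).symm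
    _ = ∫⁻ η, A.indicator 1 η ∂ν := by
        refine lintegral_congr fun η => ?_
        simp only [hf]
        rw [ENNReal.tsum_mul_right, ENNReal.tsum_mul_left]
        have hneg : ∑' φ : Λ → ℤ, eWeight β Λ (shiftConf Λ (-φ) η) = partition β Λ η :=
          (Equiv.neg (Λ → ℤ)).tsum_eq fun φ => eWeight β Λ (shiftConf Λ φ η)
        rw [hneg, ENNReal.inv_mul_cancel (partition_ne_zero Λ η)
          (partition_ne_top hG hk hreg hq hpos hν Λ η), one_mul]
    _ = ν A := lintegral_indicator_one hA

/-- A probability measure with the marginals of a boundary law satisfies the DLR equation. -/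
theorem isGradientGibbs_of_marginalOn : IsGradientGibbs hG β ν := by
  refine ⟨inferInstance, fun Λ F hF ⟨C, hC⟩ => ?_⟩
  let κ : ProbabilityTheory.Kernel (GradConf G ρ) (GradConf G ρ) :=
    ⟨gradSpec hG β Λ, measurable_gradSpec hG Λ⟩
  have hκ : ProbabilityTheory.IsMarkovKernel κ :=
    ⟨fun ζ => isProbabilityMeasure_gradSpec hG hk hreg hq hpos hν Λ ζ⟩
  have hbind : (ProbabilityTheory.Kernel.comp κ (ProbabilityTheory.Kernel.const Unit ν)) ()
      = ν := by
    ext A hA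
    rw [ProbabilityTheory.Kernel.comp_apply' _ _ _ hA, ProbabilityTheory.Kernel.const_apply]
    exact lintegral_gradSpec hG hk hreg hq hpos hν Λ hA
  have hint : Integrable F ν :=
    Integrable.of_bound hF.aestronglyMeasurable C (Filter.Eventually.of_forall hC)
  have := ProbabilityTheory.Kernel.integral_comp (η := κ)
    (κ := ProbabilityTheory.Kernel.const Unit ν) (a := ()) (f := F) (by rwa [hbind])
  rw [hbind, ProbabilityTheory.Kernel.const_apply] at this
  exact this

end DLR

/-! ### The boundary law is determined by the measure -/

/-- The boundary factor of the volume `{ρ}` when the heights at the neighbours of the root are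
`i`, `j` at two of them and `0` at the others. -/
def starFactor (k q : ℕ) (l : ℤ → ℝ) (i j : ℤ) : ℝ :=
  ∑ s ∈ Finset.range q, l (s + i) * (l (s + j) * l s ^ (k - 1))

/-- Both formulas describe the same probabilities with the same positive Boltzmann weights, so the
boundary factors are proportional. -/
lemma exists_starFactor_eq {G : SimpleGraph V} [G.LocallyFinite] {ρ : V} {k : ℕ} (hk : 2 ≤ k)
    (hreg : G.IsRegularOfDegree (k + 1)) {β : ℝ} {q q' : ℕ} {l l' : ℤ → ℝ} (hl : ∀ i, 0 < l i)
    (hl' : ∀ i, 0 < l' i) {ν : Measure (GradConf G ρ)} (h : MarginalOn G ρ β q l ν {ρ})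
    (h' : MarginalOn G ρ β q' l' ν {ρ}) :
    ∃ r : ℝ, ∀ i j, starFactor k q l i j = r * starFactor k q' l' i j := by
  classical
  have hcard : (G.neighborFinset ρ).card = k + 1 := by
    rw [SimpleGraph.card_neighborFinset_eq_degree, hreg ρ]
  obtain ⟨y, hy, z, hz, hyz⟩ := Finset.one_lt_card.mp (by omega : 1 < (G.neighborFinset ρ).card)
  have hz' : z ∈ (G.neighborFinset ρ).erase y := Finset.mem_erase.mpr ⟨hyz.symm, hz⟩
  have hfac : ∀ (q : ℕ) (l : ℤ → ℝ) (i j : ℤ),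
      bdryFactor G q l {ρ} (fun x => if x = y then i else if x = z then j else 0)
        = starFactor k q l i j := by
    intro q l i j
    refine Finset.sum_congr rfl fun s _ => ?_
    rw [outerBoundary_singleton, finprod_mem_coe_finset, ← Finset.mul_prod_erase _ _ hy,
      ← Finset.mul_prod_erase _ _ hz']
    beta_reduce
    rw [if_pos rfl, if_neg hyz.symm, if_pos rfl]
    congr 2
    rw [Finset.prod_congr rfl (g := fun _ => l s), Finset.prod_const,
      Finset.card_erase_of_mem hz', Finset.card_erase_of_mem hy, hcard]
    · congr 1
    · intro x hx
      simp only [Finset.mem_erase] at hx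
      rw [if_neg hx.2.1, if_neg hx.1, add_zero]
  have hnn : ∀ (q : ℕ) (l : ℤ → ℝ), (∀ i, 0 < l i) → ∀ i j, 0 ≤ starFactor k q l i j :=
    fun q l hl i j => Finset.sum_nonneg fun s _ =>
      (mul_pos (hl _) (mul_pos (hl _) (pow_pos (hl _) _))).le
  obtain ⟨Z, hZ, h⟩ := h
  obtain ⟨Z', hZ', h'⟩ := h'
  refine ⟨Z' / Z, fun i j => ?_⟩
  have h1 := (h fun x => if x = y then i else if x = z then j else 0).symm.trans (h' _)
  rw [hfac, hfac] at h1
  have hW := gradWeight_pos β {ρ} (grad G ρ fun x => if x = y then i else if x = z then j else 0)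
  rw [ENNReal.ofReal_eq_ofReal_iff (mul_nonneg (mul_nonneg hZ.le (hnn q l hl i j)) hW.le)
    (mul_nonneg (mul_nonneg hZ'.le (hnn q' l' hl' i j)) hW.le)] at h1
  have h2 := mul_right_cancel₀ hW.ne' h1
  field_simp
  linarith

lemma starFactor_add_period {k q : ℕ} {l : ℤ → ℝ} (hper : ∀ i, l (i + q) = l i) (i j : ℤ) :
    starFactor k q l (i + q) j = starFactor k q l i j := by
  refine Finset.sum_congr rfl fun s _ => ?_
  rw [← add_assoc, hper]

lemma starFactor_u3 {k : ℕ} (hk : 2 ≤ k) (a : ℝ) :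
    starFactor k 3 (fun n => u3 a n ^ k) 0 0 - starFactor k 3 (fun n => u3 a n ^ k) 1 0
        = (1 - a ^ k) * (1 - (a ^ k) ^ k) ∧
      starFactor k 3 (fun n => u3 a n ^ k) 1 0 - starFactor k 3 (fun n => u3 a n ^ k) 1 2
        = (1 - a ^ k) * ((1 - (a ^ k) ^ k) - (1 - a ^ k)) := by
  obtain ⟨m, rfl⟩ : ∃ m, k = m + 1 := ⟨k - 1, by omega⟩
  simp only [starFactor, Finset.sum_range_succ, Finset.sum_range_zero, u3, Nat.add_sub_cancel]
  set A := a ^ (m + 1)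
  norm_num
  constructor <;> ring

/-- Subtracting gives `(1 - A)^2 = r (1 - B)^2`. Dividing the first equation by this leaves equality
of two geometric sums, which are strictly increasing in the base. -/
lemma eq_of_slope_eq {k : ℕ} (hk : 2 ≤ k) {A B r : ℝ} (hA : 0 < A) (hB : 0 < B) (hA1 : A ≠ 1)
    (hB1 : B ≠ 1) (h1 : (1 - A) * (1 - A ^ k) = r * ((1 - B) * (1 - B ^ k)))
    (h2 : (1 - A) * ((1 - A ^ k) - (1 - A)) = r * ((1 - B) * ((1 - B ^ k) - (1 - B)))) :
    A = B := by
  have gA : (∑ i ∈ Finset.range k, A ^ i) * (1 - A) = 1 - A ^ k := geom_sum_mul_neg A k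
  have gB : (∑ i ∈ Finset.range k, B ^ i) * (1 - B) = 1 - B ^ k := geom_sum_mul_neg B k
  have hA' : 1 - A ≠ 0 := sub_ne_zero.mpr hA1.symm
  have hB' : 1 - B ≠ 0 := sub_ne_zero.mpr hB1.symm
  have hmono : StrictMonoOn (fun x : ℝ => ∑ i ∈ Finset.range k, x ^ i) (Set.Ioi 0) := by
    intro x hx y _ hxy
    refine Finset.sum_lt_sum (fun i _ => pow_le_pow_left₀ (le_of_lt hx) hxy.le i)
      ⟨1, Finset.mem_range.mpr (by omega), ?_⟩
    simpa using hxy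
  refine hmono.injOn hA hB ?_
  have hgA : 0 < ∑ i ∈ Finset.range k, A ^ i :=
    Finset.sum_pos (fun i _ => pow_pos hA i) ⟨0, by simp; omega⟩
  set S := ∑ i ∈ Finset.range k, A ^ i
  set T := ∑ i ∈ Finset.range k, B ^ i
  rw [← gA, ← gB] at h1 h2
  have e1 : (1 - A) ^ 2 = r * (1 - B) ^ 2 := by linear_combination h1 - h2
  have e2 : (1 - A) ^ 2 * S = (1 - A) ^ 2 * T := by
    linear_combination h1 - T * e1
  exact mul_left_cancel₀ (pow_ne_zero 2 hA') e2

/-! ### Counting the measures of type 3 and separating them from the 4-periodic ones. -/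

section Classification

variable {G : SimpleGraph V} [G.LocallyFinite] (hG : G.IsTree) {ρ : V} {k : ℕ} {β : ℝ}

lemma u3_pow_periodic (k : ℕ) (a : ℝ) (i : ℤ) :
    (fun n => u3 a n ^ k) (i + (3 : ℕ)) = (fun n => u3 a n ^ k) i := by
  simp only [Nat.cast_ofNat, u3_add_three]

lemma pow_ne_one_of_ne_one (hk : k ≠ 0) {a : ℝ} (ha : 0 < a) (ha1 : a ≠ 1) : a ^ k ≠ 1 :=
  fun h => ha1 ((pow_eq_one_iff_of_nonneg ha.le hk).mp h)

theorem disjoint_ggm3_ggm4 (hk : 2 ≤ k) (hreg : G.IsRegularOfDegree (k + 1)) :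
    Disjoint (ggm3 hG ρ k β) (ggm4 hG ρ k β) := by
  rw [Set.disjoint_left]
  rintro ν ⟨a, ha, ha1, hl, hper, -, hM⟩ ⟨c, d, -, -, hl', hper', -, hM'⟩
  obtain ⟨r, hr⟩ := exists_starFactor_eq hk hreg hl.1 hl'.1
    ((hasMarginals_iff hG hper).mp hM {ρ} (connected_singleton ρ))
    ((hasMarginals_iff hG hper').mp hM' {ρ} (connected_singleton ρ))
  have h1 := starFactor_add_period (k := k) (q := 3) (l := fun n => u3 a n ^ k) hper 1 0
  have h2 := starFactor_add_period (k := k) (q := 4) (l := fun n => u4 c d n ^ k) hper' 0 0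
  -- Height `4` is `1` modulo 3 and `0` modulo 4, so the star sums at `1` and `0` coincide.
  have h3 := hr 4 0
  have h4 := hr 0 0
  norm_num at h1 h2
  have hD := (starFactor_u3 hk a).1
  rw [h4, ← h2, ← h3, h1, sub_self] at hD
  have hA : 0 < a ^ k := pow_pos ha k
  have hA1 := pow_ne_one_of_ne_one (by omega : k ≠ 0) ha ha1
  have hA2 := pow_ne_one_of_ne_one (by omega : k ≠ 0) hA hA1
  exact mul_ne_zero (sub_ne_zero.mpr hA1.symm) (sub_ne_zero.mpr hA2.symm) hD.symm

/-- The gradient Gibbs measures of type `3` correspond to the points of the curve. -/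
theorem encard_ggm3 (hk : 2 ≤ k) (hreg : G.IsRegularOfDegree (k + 1)) (hβ : 0 < β) :
    (ggm3 hG ρ k β).encard
      = {a : ℝ | 0 < a ∧ a ≠ 1 ∧ tauCurve k a = 2 * Real.cosh β}.encard := by
  have hex : ∀ a ∈ {a : ℝ | 0 < a ∧ a ≠ 1 ∧ tauCurve k a = 2 * Real.cosh β},
      ∃ ν : Measure (GradConf G ρ), IsGGMOf hG k β 3 (fun n => u3 a n ^ k) ν := by
    rintro a ⟨ha, ha1, hτ⟩
    have hl := (isBoundaryLaw_u3_iff hk hβ ha ha1).mpr hτ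
    obtain ⟨ν, hprob, hν⟩ := exists_measure_marginalOn hG (ρ := ρ) hreg hl
      (by norm_num : 0 < 3) (u3_pow_periodic k a)
    exact ⟨ν, hl, u3_pow_periodic k a, isGradientGibbs_of_marginalOn hG (by omega : 1 ≤ k) hreg
      (by norm_num : 0 < 3) hl.1 hν, (hasMarginals_iff hG (u3_pow_periodic k a)).mpr hν⟩
  choose! N hN using hex
  have himage : ggm3 hG ρ k β = N '' {a : ℝ | 0 < a ∧ a ≠ 1 ∧ tauCurve k a = 2 * Real.cosh β} := by
    ext ν
    constructor
    · rintro ⟨a, ha, ha1, hν⟩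
      have hmem : a ∈ {a : ℝ | 0 < a ∧ a ≠ 1 ∧ tauCurve k a = 2 * Real.cosh β} :=
        ⟨ha, ha1, (isBoundaryLaw_u3_iff hk hβ ha ha1).mp hν.1⟩
      refine ⟨a, hmem, ?_⟩
      obtain ⟨-, hper, ⟨hp1, -⟩, hM1⟩ := hN a hmem
      obtain ⟨-, -, ⟨hp2, -⟩, hM2⟩ := hν
      exact MarginalOn.eq_of_isProbabilityMeasure hG ((hasMarginals_iff hG hper).mp hM1)
        ((hasMarginals_iff hG hper).mp hM2)
    · rintro ⟨a, ha, rfl⟩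
      exact ⟨a, ha.1, ha.2.1, hN a ha⟩
  rw [himage]
  refine Set.InjOn.encard_image fun a ha b hb hab => ?_
  obtain ⟨hl1, hper1, -, hM1⟩ := hN a ha
  obtain ⟨hl2, hper2, -, hM2⟩ := hN b hb
  -- The common measure now has the marginals of both laws, for `a` and for `b`.
  rw [hab] at hM1
  obtain ⟨r, hr⟩ := exists_starFactor_eq hk hreg hl1.1 hl2.1
    ((hasMarginals_iff hG hper1).mp hM1 {ρ} (connected_singleton ρ))
    ((hasMarginals_iff hG hper2).mp hM2 {ρ} (connected_singleton ρ))
  have hk0 : k ≠ 0 := by omega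
  have h1 := (starFactor_u3 hk a).1
  have h2 := (starFactor_u3 hk a).2
  have h1' := (starFactor_u3 hk b).1
  have h2' := (starFactor_u3 hk b).2
  rw [hr, hr, ← mul_sub, h1'] at h1
  rw [hr, hr, ← mul_sub, h2'] at h2
  have := eq_of_slope_eq hk (pow_pos ha.1 k) (pow_pos hb.1 k)
    (pow_ne_one_of_ne_one hk0 ha.1 ha.2.1) (pow_ne_one_of_ne_one hk0 hb.1 hb.2.1) h1.symm h2.symm
  exact (pow_left_inj₀ ha.1.le hb.1.le hk0).mp this

end Classification

end

end SOS

theorem mainTheorem2 (k : ℕ) (hk : 2 ≤ k) :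
    ∃ τc : ℝ, 0 < τc ∧ τc < (2 * (k : ℝ) + 1) / ((k : ℝ) - 1) ∧
      ∀ (V : Type*) (G : SimpleGraph V) [G.LocallyFinite] (hG : G.IsTree)
        (_ : G.IsRegularOfDegree (k + 1)) (ρ : V) (β : ℝ) (_ : 0 < β),
        (2 * Real.cosh β < τc → SOS.ggm3 hG ρ k β = ∅) ∧
        (2 * Real.cosh β = τc → (SOS.ggm3 hG ρ k β).encard = 1) ∧
        (τc < 2 * Real.cosh β → 2 * Real.cosh β ≠ (2 * (k : ℝ) + 1) / ((k : ℝ) - 1) →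
          (SOS.ggm3 hG ρ k β).encard = 2) ∧
        (2 * Real.cosh β = (2 * (k : ℝ) + 1) / ((k : ℝ) - 1) →
          (SOS.ggm3 hG ρ k β).encard = 1) ∧
        Disjoint (SOS.ggm3 hG ρ k β) (SOS.ggm4 hG ρ k β) := by
  obtain ⟨τc, h0, h1, hcount⟩ := SOS.exists_tau_crit hk
  rw [SOS.tauCurve_one hk] at h1 hcount
  refine ⟨τc, h0, h1, fun V G _ hG hreg ρ β hβ => ?_⟩
  obtain ⟨c1, c2, c3, c4⟩ := hcount (2 * Real.cosh β)
  rw [← Set.encard_eq_zero, SOS.encard_ggm3 hG hk hreg hβ, Set.encard_eq_zero]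
  exact ⟨c1, c2, c3, c4, SOS.disjoint_ggm3_ggm4 hG hk hreg⟩
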